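/- Let $\mathcal N$ be a finite set of $N=|\mathcal N|\ge 1$ mobile operators, each licensing one spectrum band, so that bands are also indexed by $\mathcal N$. The base stations of operator $j$ form a homogeneous Poisson point process $\Phi_j\subset\mathbb R^2$ of intensity $\lambda_j>0$, the processes being independent; put $\Phi=\bigcup_j\Phi_j$. For $y\in\Phi$ and $k\in\mathcal N$ let $h_y^k$ be the power fading between $y$ and the reference user, located at the origin, in band $k$; under frequency-selective Rayleigh fading all the $h_y^k$ are i.i.d. exponential with mean one and independent of the point processes. The reference user of operator $n$ is served by the point $x\in\Phi_n$ nearest to the origin, and all spectrum is shared without infrastructure sharing. With path-loss exponent $\alpha=4$ and no noise, for $k\in\mathcal N$, $$\mathrm{SINR}_k=\frac{h_x^k\|x\|^{-4}}{\sum_{y\in\Phi\setminus\{x\}}h_y^k\|y\|^{-4}} .$$ For $\theta>0$ let $p_n(\theta)=\mathbb P\big(\bigcup_{k\in\mathcal N}\{\mathrm{SINR}_k>\theta\}\big)$ be the probability of coverage in at least one band. For integers $l\ge1$ put $$\mathfrak Z(\theta,\alpha,l)=\frac{2\theta^l}{l\alpha-2}\,{}_2F_1\big(l,\,l-\tfrac2\alpha;\,l-\tfrac2\alpha+1;\,-\theta\big),\qquad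 \mathfrak Z_0(\theta,\alpha,l)=\frac{2\theta^{2/\alpha}}{\alpha}\,B\big(\tfrac2\alpha,\,l-\tfrac2\alpha\big),$$ $$\tilde{\mathfrak Z}_0(l)=\frac{\sqrt\theta}{2}\sqrt{\frac{\pi}{l}},$$ where ${}_2F_1$ is the Gauss hypergeometric function (continued analytically to $(-\infty,1)$) and $B$ is the beta function. For a sequence $z=(z(l))_{l\ge 1}$ of real numbers and $1\le k\le N$ let $$D_k[z]=1+\sum_{l=1}^k\binom kl(-1)^{l+1}\Big(\mathfrak Z(\theta,4,l)+\sum_{j\in\mathcal N\setminus\{n\}}\frac{\lambda_j}{\lambda_n}\,z(l)\Big),$$ and write $D_k=D_k[\mathfrak Z_0(\theta,4,\cdot)]$, $\tilde D_k=D_k[\tilde{\mathfrak Z}_0]$. Then $D_k\ge1$ and $\tilde D_k\ge1$ for $1\le k\le N$, and the following hold. 1. The coverage probability is exactly $$p_n(\theta)=\sum_{k=1}^{N}\frac{\binom Nk(-1)^{k+1}}{D_k}.$$ 2. $\mathfrak Z_0(\theta,4,l)\approx\frac{\sqrt\theta}{2}\sqrt{\pi/l}$ in the following sense: $\mathfrak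 Z_0(\theta,4,l)\sim\tilde{\mathfrak Z}_0(l)$ as $l\to\infty$, and $\tilde{\mathfrak Z}_0(l)\le\mathfrak Z_0(\theta,4,l)\le(1+\tfrac1l)\,\tilde{\mathfrak Z}_0(l)$ for every $l\ge1$. 3. Replacing $\mathfrak Z_0(\theta,4,l)$ by its approximation in the formula of part 1 gives an approximation of $p_n(\theta)$ with $$\Big|\,p_n(\theta)-\sum_{k=1}^{N}\frac{\binom Nk(-1)^{k+1}}{\tilde D_k}\Big|\le\sum_{k=1}^{N}\frac{\binom Nk}{D_k\tilde D_k}\sum_{l=1}^k\binom kl\sum_{j\in\mathcal N\setminus\{n\}}\frac{\lambda_j}{\lambda_n}\,\frac{\tilde{\mathfrak Z}_0(l)}{l}.$$ -/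

import Mathlib

open MeasureTheory ProbabilityTheory
open scoped ENNReal

/-! ### Special functions -/

/-- The Gauss hypergeometric function `₂F₁(a, b; c; z)` for real parameters with `0 < b < c` and a
real argument `z < 1`, given by Euler's integral. It is the analytic continuation to `z < 1` of the
hypergeometric series, which converges only for `|z| < 1`; see
`gaussHypergeometric_eq_ordinaryHypergeometric` for the agreement of the two. -/
noncomputable def gaussHypergeometric (a b c z : ℝ) : ℝ :=
  (∫ t in (0 : ℝ)..1, t ^ (b - 1) * (1 - t) ^ (c - b - 1) * (1 - z * t) ^ (-a)) / beta b (c - b)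

theorem beta_integrand_ofReal {x y t : ℝ} (ht : t ∈ Set.Ioc (0 : ℝ) 1) :
    ((t ^ (x - 1) * (1 - t) ^ (y - 1) : ℝ) : ℂ) =
      (t : ℂ) ^ ((x : ℂ) - 1) * (1 - (t : ℂ)) ^ ((y : ℂ) - 1) := by
  rw [Complex.ofReal_mul, Complex.ofReal_cpow ht.1.le, Complex.ofReal_cpow (by linarith [ht.2])]
  push_cast
  rfl

theorem integrableOn_beta {x y : ℝ} (hx : 0 < x) (hy : 0 < y) :
    IntegrableOn (fun t : ℝ => t ^ (x - 1) * (1 - t) ^ (y - 1)) (Set.Ioc 0 1) := by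
  have h := (Complex.betaIntegral_convergent (u := x) (v := y) (by simpa) (by simpa))
  rw [intervalIntegrable_iff_integrableOn_Ioc_of_le zero_le_one] at h
  refine (h.re).congr ?_
  filter_upwards [ae_restrict_mem measurableSet_Ioc] with t ht
  rw [← beta_integrand_ofReal ht]
  simp

theorem integral_beta {x y : ℝ} (hx : 0 < x) (hy : 0 < y) :
    ∫ t in Set.Ioc (0 : ℝ) 1, t ^ (x - 1) * (1 - t) ^ (y - 1) = beta x y := by
  rw [beta_eq_betaIntegralReal x y hx hy, Complex.betaIntegral,
    intervalIntegral.integral_of_le zero_le_one,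
    ← setIntegral_congr_fun measurableSet_Ioc (fun t ht => beta_integrand_ofReal ht),
    integral_complex_ofReal, Complex.ofReal_re]

theorem beta_add_nat {x y : ℝ} (hx : 0 < x) (hy : 0 < y) (n : ℕ) :
    beta (x + n) y = beta x y * ((ascPochhammer ℝ n).eval x * ((ascPochhammer ℝ n).eval (x + y))⁻¹) := by
  have hG : ∀ z : ℝ, 0 < z → Real.Gamma (z + n) = (ascPochhammer ℝ n).eval z * Real.Gamma z := by
    intro z hz
    induction n with
    | zero => simp
    | succ n ih =>
      rw [ascPochhammer_succ_right, Nat.cast_succ, ← add_assoc, Real.Gamma_add_one (by positivity), ih]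
      simp
      ring
  have h1 := (ascPochhammer_pos n (x + y) (by positivity)).ne'
  have h2 := (Real.Gamma_pos_of_pos (add_pos hx hy)).ne'
  rw [beta, beta, show x + n + y = (x + y) + n by ring, hG x hx, hG _ (add_pos hx hy)]
  field_simp

theorem hasSum_one_sub_rpow_neg (a : ℝ) {x : ℝ} (hx : |x| < 1) :
    HasSum (fun n : ℕ => ((n.factorial : ℝ)⁻¹ * (ascPochhammer ℝ n).eval a) * x ^ n)
      ((1 - x) ^ (-a)) ∧
    Summable (fun n : ℕ => |((n.factorial : ℝ)⁻¹ * (ascPochhammer ℝ n).eval a) * x ^ n|) := by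
  have h := Real.one_div_one_sub_rpow_hasFPowerSeriesOnBall_zero a
  have hx' : x ∈ Metric.eball (0 : ℝ) 1 := by
    simpa [enorm_eq_nnnorm, ← NNReal.coe_lt_coe] using hx
  have hc : ∀ n : ℕ, Ring.choose (a + n - 1) n =
      (n.factorial : ℝ)⁻¹ * (ascPochhammer ℝ n).eval a := by
    intro n
    have := Ring.factorial_nsmul_multichoose_eq_ascPochhammer a n
    rw [Ring.multichoose_eq, Polynomial.ascPochhammer_smeval_eq_eval, nsmul_eq_mul] at this
    rw [← this, inv_mul_cancel_left₀ (by positivity)]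
  constructor
  · have := h.hasSum hx'
    simp only [zero_add, FormalMultilinearSeries.ofScalars_apply_eq, hc, smul_eq_mul] at this
    rwa [Real.rpow_neg (by linarith [(abs_lt.1 hx).2]), ← one_div]
  · have := FormalMultilinearSeries.summable_norm_apply _ (Metric.eball_subset_eball h.r_le hx')
    simpa only [FormalMultilinearSeries.ofScalars_apply_eq, hc, smul_eq_mul, Real.norm_eq_abs] using this

theorem gaussHypergeometric_eq_ordinaryHypergeometric {a b c z : ℝ} (hb : 0 < b) (hbc : b < c)
    (hz : |z| < 1) : gaussHypergeometric a b c z = ordinaryHypergeometric a b c z := by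
  have hy : 0 < c - b := by linarith
  set A : ℕ → ℝ := fun n => (n.factorial : ℝ)⁻¹ * (ascPochhammer ℝ n).eval a with hA
  have hB := (beta_pos hb hy).ne'
  set F : ℕ → ℝ → ℝ := fun n t =>
    (A n * z ^ n) * (t ^ (b + n - 1) * (1 - t) ^ (c - b - 1)) with hF
  have hFi : ∀ n, IntegrableOn (F n) (Set.Ioc 0 1) := fun n =>
    (integrableOn_beta (by positivity) hy).const_mul _
  have hS : Summable fun n => ∫ t in Set.Ioc (0 : ℝ) 1, ‖F n t‖ := by
    refine Summable.of_nonneg_of_le (fun n => integral_nonneg fun t => norm_nonneg _) ?_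
      ((hasSum_one_sub_rpow_neg a hz).2.mul_right (beta b (c - b)))
    intro n
    rw [← integral_beta hb hy, ← integral_const_mul]
    refine setIntegral_mono_on (hFi n).norm ((integrableOn_beta hb hy).const_mul _)
      measurableSet_Ioc fun t ht => ?_
    have h1 : 0 ≤ (1 - t) ^ (c - b - 1) := Real.rpow_nonneg (by linarith [ht.2]) _
    have h2 : 0 ≤ t ^ (b + n - 1) := Real.rpow_nonneg ht.1.le _
    rw [hF, Real.norm_eq_abs, abs_mul, abs_of_nonneg (mul_nonneg h2 h1)]
    gcongr _ * (?_ * _)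
    exact Real.rpow_le_rpow_of_exponent_ge ht.1 ht.2 (by linarith [n.cast_nonneg (α := ℝ)])
  have hsum := hasSum_integral_of_summable_integral_norm hFi hS
  have hval : ∫ t in Set.Ioc (0 : ℝ) 1, ∑' n, F n t =
      ∫ t in Set.Ioc (0 : ℝ) 1, t ^ (b - 1) * (1 - t) ^ (c - b - 1) * (1 - z * t) ^ (-a) := by
    refine setIntegral_congr_fun measurableSet_Ioc fun t ht => ?_
    have hzt : |z * t| < 1 := by
      rw [abs_mul, abs_of_pos ht.1]
      nlinarith [abs_nonneg z, ht.1, ht.2]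
    have := ((hasSum_one_sub_rpow_neg a hzt).1.mul_left (t ^ (b - 1) * (1 - t) ^ (c - b - 1))).tsum_eq
    show ∑' n, F n t = _
    rw [← this]
    refine tsum_congr fun n => ?_
    simp only [hF, hA]
    rw [show b + n - 1 = (b - 1) + n by ring, Real.rpow_add ht.1, Real.rpow_natCast, mul_pow]
    ring
  rw [gaussHypergeometric, intervalIntegral.integral_of_le zero_le_one, ← hval, ← hsum.tsum_eq,
    ordinaryHypergeometric_eq_tsum, ← tsum_div_const]
  refine tsum_congr fun n => ?_
  simp only [hF]
  rw [integral_const_mul, integral_beta (by positivity) hy, beta_add_nat hb hy,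
    add_sub_cancel, smul_eq_mul]
  simp only [hA]
  field_simp

/-- `𝔷(θ, α, l) = 2 θ^l / (l α - 2) * ₂F₁(l, l - 2/α; l - 2/α + 1; -θ)`. -/
noncomputable def zFar (θ α : ℝ) (l : ℕ) : ℝ :=
  2 * θ ^ l / (l * α - 2) * gaussHypergeometric l (l - 2 / α) (l - 2 / α + 1) (-θ)

/-- `𝔷₀(θ, α, l) = (2 θ^(2/α) / α) * B(2/α, l - 2/α)`, with `B` Euler's beta function. -/
noncomputable def zZero (θ α : ℝ) (l : ℕ) : ℝ :=
  2 * θ ^ (2 / α) / α * beta (2 / α) (l - 2 / α)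

/-! ### Networks of base stations -/

/-- The Euclidean plane. -/
abbrev Plane : Type := EuclideanSpace ℝ (Fin 2)

section Model

variable {Ω : Type*} [MeasurableSpace Ω] {ι : Type*}

/-- The counting measure of the point process whose points are `X 0, X 1, …`. -/
noncomputable def pointMeasure (X : ℕ → Ω → Plane) (ω : Ω) : Measure Plane :=
  Measure.sum fun i => Measure.dirac (X i ω)

/-- The random points `X 0, X 1, …` form a homogeneous Poisson point process of intensity `lam`
in the plane: the number of points in a Borel set `B` of finite area is Poisson distributed with
mean `lam * area B`, and the numbers of points in disjoint Borel sets are independent. -/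
structure IsPoissonPointProcess (P : Measure Ω) (lam : ℝ) (X : ℕ → Ω → Plane) : Prop where
  measurable_point : ∀ i, Measurable (X i)
  count_law : ∀ B : Set Plane, MeasurableSet B → volume B ≠ ∞ →
    HasLaw (fun ω => pointMeasure X ω B)
      ((poissonMeasure (ENNReal.ofReal lam * volume B).toNNReal).map
        (fun m : ℕ => (m : ℝ≥0∞))) P
  count_indep : ∀ (m : ℕ) (B : Fin m → Set Plane), (∀ i, MeasurableSet (B i)) →
    Pairwise (Function.onFun Disjoint B) → iIndepFun (fun i ω => pointMeasure X ω (B i)) P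

/-- The multi-operator network under frequency-selective Rayleigh fading. The operators, and also
the spectrum bands they license, are indexed by `ι`; `X j i` is the location of the `i`-th base
station of operator `j`, and `h j i k` is the power fading in band `k` between that base station and
the reference user at the origin. -/
structure IsFreqSelectiveNetwork (P : Measure Ω) (lam : ι → ℝ) (X : ι → ℕ → Ω → Plane)
    (h : ι → ℕ → ι → Ω → ℝ) : Prop where
  poisson : ∀ j, IsPoissonPointProcess P (lam j) (X j)
  operators_indep : iIndepFun (fun j ω => pointMeasure (X j) ω) P
  fading_measurable : ∀ j i k, Measurable (h j i k)
  fading_law : ∀ j i k, HasLaw (h j i k) (expMeasure 1) P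
  fading_indep : iIndepFun (fun (q : ι × ℕ × ι) ω => h q.1 q.2.1 q.2.2 ω) P
  fading_indep_points :
    IndepFun (fun ω (j : ι) (i : ℕ) => X j i ω) (fun ω (j : ι) (i : ℕ) (k : ι) => h j i k ω) P

/-- Power `h_y ‖y‖^(-α)` received at the origin in band `k` from base station `q = (j, i)`. -/
noncomputable def receivedPower (α : ℝ) (X : ι → ℕ → Ω → Plane) (h : ι → ℕ → ι → Ω → ℝ)
    (k : ι) (q : ι × ℕ) (ω : Ω) : ℝ≥0∞ :=
  ENNReal.ofReal (h q.1 q.2 k ω) * ‖X q.1 q.2 ω‖ₑ ^ (-α)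

/-- The `SINR` in band `k` when the base station `x` serves the reference user and spectrum is
shared: all other base stations, of all operators, interfere. `W` is the noise power and `η` the
power splitting factor. -/
noncomputable def sinr (α W η : ℝ) (X : ι → ℕ → Ω → Plane) (h : ι → ℕ → ι → Ω → ℝ)
    (k : ι) (x : ι × ℕ) (ω : Ω) : ℝ≥0∞ :=
  receivedPower α X h k x ω /
    (ENNReal.ofReal (η * W) + ∑' y : {y : ι × ℕ // y ≠ x}, receivedPower α X h k y ω)

/-- The reference user of operator `n` is covered: served by a nearest base station of operator
`n`, it has `SINR > θ` in at least one of the shared bands. All bands are in use, so that the power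
splitting factor is the number of bands. -/
def IsCovered [Fintype ι] (α W : ℝ) (X : ι → ℕ → Ω → Plane) (h : ι → ℕ → ι → Ω → ℝ)
    (n : ι) (θ : ℝ) (ω : Ω) : Prop :=
  ∃ i : ℕ, (∀ i', ‖X n i ω‖ ≤ ‖X n i' ω‖) ∧
    ∃ k : ι, ENNReal.ofReal θ < sinr α W (Fintype.card ι) X h k (n, i) ω

/-- The coverage probability `p_n(θ)` from sharing of spectrum under frequency-selective fading. -/
noncomputable def coverageProbability [Fintype ι] (P : Measure Ω) (α W : ℝ)
    (X : ι → ℕ → Ω → Plane) (h : ι → ℕ → ι → Ω → ℝ) (n : ι) (θ : ℝ) : ℝ :=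
  P.real {ω | IsCovered α W X h n θ ω}

end Model

section ClosedForm

variable {ι : Type*} [Fintype ι] [DecidableEq ι]

/-- `1 + ∑_{l=1}^k C(k,l) (-1)^(l+1) (𝔷(θ,4,l) + ∑_{j ≠ n} (lam_j / lam_n) z(l))`. -/
noncomputable def coverageDenominator (lam : ι → ℝ) (n : ι) (θ : ℝ) (z : ℕ → ℝ) (k : ℕ) : ℝ :=
  1 + ∑ l ∈ Finset.Icc 1 k, (k.choose l : ℝ) * (-1) ^ (l + 1) *
    (zFar θ 4 l + ∑ j ∈ Finset.univ.erase n, lam j / lam n * z l)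

/-- The inclusion–exclusion form `∑_{k=1}^N C(N,k) (-1)^(k+1) / coverageDenominator k`, where `N` is
the number of operators. -/
noncomputable def coverageForm (lam : ι → ℝ) (n : ι) (θ : ℝ) (z : ℕ → ℝ) : ℝ :=
  ∑ k ∈ Finset.Icc 1 (Fintype.card ι),
    ((Fintype.card ι).choose k : ℝ) * (-1) ^ (k + 1) / coverageDenominator lam n θ z k

end ClosedForm

/-- The large-`l` approximation `(√θ / 2) √(π / l)` of `𝔷₀(θ, 4, l)`. -/
noncomputable def zZeroApprox (θ : ℝ) (l : ℕ) : ℝ :=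
  √θ / 2 * √(Real.pi / l)

/-! Fix the point configuration and let `s` be the squared distance of the serving point. In a given
band, coverage means that one exponential variable exceeds an independent sum of exponentials with
weights `θ (s/v)²`, where `v` runs over the squared distances of the interferers. Its probability is
`Q = ∏ (1 + θ (s/v)²)⁻¹`, the same for every band. The bands use disjoint families of fading
variables, so the conditional coverage probability is `1 - (1 - Q)^N`
(`IsFreqSelectiveNetwork.measure_isCovered_const`), and the binomial expansion leaves the moments of
`Q`.

Write `Q = exp (-loss)`. Given `s`, the other points of operator `n` form a Poisson process outside
the disc of squared radius `s`, while the other operators are unaffected. By the Laplace functional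
(`IsPoissonPointProcess.lintegral_expNeg_lintegral`) and the scaling `w = v / s`, the conditional
mean of `Q^k` is `exp (-λ_n π (D_k - 1) s)`, see `lossExponent_Ioi`. Since `s` is exponential of
rate `λ_n π`, averaging gives `1 / D_k`. Conditioning on `s` is done by hand: `s` is rounded to
dyadic cells, where void events are themselves Laplace functionals, and the mesh tends to zero
(`lintegral_expNeg_totalLoss_nearestSq`).

With `u = θ / (w² + θ)`, the exponent contains integrals of `1 - (1 - u)^k`, over `w > 1` for
operator `n` and over `w > 0` for the others. Expanding by `sum_choose_mul_neg_one_pow` produces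
integrals of `u^l`, which are `zFar` and `zZero`. Positivity of `1 - (1 - u)^k` gives `1 ≤ D_k`; for
the approximate coefficients the same argument works with `u = exp (-t)`, because `1/√l` is a
multiple of `∫ t^(-1/2) exp (-l t)`.

For `α = 4` the coefficient `zZero` is a multiple of `Γ(l - 1/2) / Γ(l)`, which log-convexity of `Γ`
compares with `1/√l`. The error bound then follows from `1/D - 1/D' = (D' - D)/(D D')`, estimated
term by term. -/

/-! ### Integral representations of `zFar` and `zZero` -/

theorem integrableOn_div_sq_add_pow {θ : ℝ} (hθ : 0 < θ) {l : ℕ} (hl : 1 ≤ l) :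
    Integrable (fun w : ℝ => (θ / (w ^ 2 + θ)) ^ l) := by
  -- The case `l = 1` is a rescaled Cauchy density; it dominates all higher powers because the base
  -- lies in `[0, 1]`.
  have h1 : Integrable (fun w : ℝ => θ / (w ^ 2 + θ)) := by
    have h := integrable_inv_one_add_sq.comp_mul_left' (R := (√θ)⁻¹) (by positivity)
    refine h.congr (Filter.Eventually.of_forall fun w => ?_)
    have h2 : √θ ^ 2 = θ := Real.sq_sqrt hθ.le
    simp only [mul_pow, inv_pow, h2]
    field_simp
    ring
  refine h1.mono (h1.aestronglyMeasurable.pow l) (Filter.Eventually.of_forall fun w => ?_)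
  have h3 : 0 ≤ θ / (w ^ 2 + θ) := by positivity
  have h4 : θ / (w ^ 2 + θ) ≤ 1 := by rw [div_le_one (by positivity)]; nlinarith [sq_nonneg w]
  rw [Real.norm_of_nonneg (by positivity), Real.norm_of_nonneg h3]
  simpa using pow_le_pow_of_le_one h3 h4 hl

theorem image_inv_sq_Ioi_one : (fun w : ℝ => (w ^ 2)⁻¹) '' Set.Ioi 1 = Set.Ioo 0 1 := by
  ext t
  constructor
  · rintro ⟨w, hw, rfl⟩
    have hw' : (1 : ℝ) < w := hw
    exact ⟨by positivity, inv_lt_one_of_one_lt₀ (by nlinarith)⟩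
  · rintro ⟨h0, h1⟩
    refine ⟨(√t)⁻¹, ?_, ?_⟩
    · exact (one_lt_inv₀ (Real.sqrt_pos.2 h0)).2 (by rw [Real.sqrt_lt' one_pos]; simpa using h1)
    · simp only [inv_pow, Real.sq_sqrt h0.le, inv_inv]

/-- Substitute `t = 1 / w²` in Euler's integral. Here `c - b = 1`, so the factor in `1 - t`
disappears and the normalising beta value is `1 / b`. -/
theorem integral_Ioi_one_eq_zFar {θ : ℝ} (hθ : 0 < θ) {l : ℕ} (hl : 1 ≤ l) :
    ∫ w in Set.Ioi (1 : ℝ), (θ / (w ^ 2 + θ)) ^ l = zFar θ 4 l := by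
  have hl' : (1 : ℝ) ≤ l := by exact_mod_cast hl
  have hb : (0 : ℝ) < l - 2 / 4 := by linarith
  have hbeta : beta (l - 2 / 4) ((l : ℝ) - 2 / 4 + 1 - (l - 2 / 4)) = ((l : ℝ) - 2 / 4)⁻¹ := by
    have := (Real.Gamma_pos_of_pos hb).ne'
    rw [add_sub_cancel_left, beta, Real.Gamma_one, Real.Gamma_add_one hb.ne', mul_one,
      div_mul_cancel_right₀ this]
  have hint : ∫ t in Set.Ioo (0 : ℝ) 1, t ^ ((l : ℝ) - 2 / 4 - 1) * (1 + θ * t) ^ (-(l : ℝ)) =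
      ∫ w in Set.Ioi (1 : ℝ), 2 * (((w ^ 2 + θ)) ^ l)⁻¹ := by
    rw [← image_inv_sq_Ioi_one, integral_image_eq_integral_abs_deriv_smul
      (f' := fun w => -(2 * w) / (w ^ 2) ^ 2) measurableSet_Ioi]
    · refine setIntegral_congr_fun measurableSet_Ioi fun w hw => ?_
      have hw' : (1 : ℝ) < w := hw
      have hw0 : (0 : ℝ) < w := by linarith
      have e1 : ((w ^ 2)⁻¹ : ℝ) ^ ((l : ℝ) - 2 / 4 - 1) = w ^ 3 / (w ^ 2) ^ l := by
        rw [← Real.rpow_natCast w 2, ← Real.rpow_neg hw0.le, ← Real.rpow_mul hw0.le,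
          show (-((2 : ℕ) : ℝ)) * ((l : ℝ) - 2 / 4 - 1) = ((3 : ℕ) : ℝ) - ((2 * l : ℕ) : ℝ) by
            push_cast; ring, Real.rpow_sub hw0, Real.rpow_natCast, Real.rpow_natCast,
          Real.rpow_natCast, pow_mul]
      have e2 : (1 + θ * (w ^ 2)⁻¹) ^ (-(l : ℝ)) = (w ^ 2) ^ l / (w ^ 2 + θ) ^ l := by
        rw [Real.rpow_neg (by positivity), Real.rpow_natCast, ← inv_pow, ← div_pow]
        congr 1
        field_simp
      have e3 : |-(2 * w) / (w ^ 2) ^ 2| = 2 * w / (w ^ 2) ^ 2 := by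
        rw [neg_div, abs_neg, abs_of_pos (by positivity)]
      simp only [e1, e2, e3, smul_eq_mul]
      field_simp
    · intro w hw
      have hw' : (1 : ℝ) < w := hw
      have h := ((hasDerivAt_pow 2 w).inv (by positivity)).hasDerivWithinAt (s := Set.Ioi 1)
      exact h.congr_deriv (by simp)
    · intro a ha b hb hab
      have ha' : (1 : ℝ) < a := ha
      have hb' : (1 : ℝ) < b := hb
      have : a ^ 2 = b ^ 2 := inv_injective hab
      exact (pow_left_inj₀ (by linarith) (by linarith) two_ne_zero).1 this
  rw [zFar, gaussHypergeometric, hbeta, intervalIntegral.integral_of_le zero_le_one,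
    integral_Ioc_eq_integral_Ioo]
  have : ∀ t : ℝ, t ^ ((l : ℝ) - 2 / 4 - 1) * (1 - t) ^ ((l : ℝ) - 2 / 4 + 1 - (l - 2 / 4) - 1) *
      (1 - -θ * t) ^ (-(l : ℝ)) = t ^ ((l : ℝ) - 2 / 4 - 1) * (1 + θ * t) ^ (-(l : ℝ)) := by
    intro t
    rw [show (l : ℝ) - 2 / 4 + 1 - (l - 2 / 4) - 1 = 0 by ring, Real.rpow_zero, mul_one,
      show 1 - -θ * t = 1 + θ * t by ring]
  simp_rw [this, hint, integral_const_mul, div_pow, div_eq_mul_inv, integral_const_mul]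
  have h4 : (l : ℝ) * 4 - 2 ≠ 0 := by linarith
  have h5 : (l : ℝ) - 2 * 4⁻¹ ≠ 0 := by linarith
  field_simp
  ring

theorem image_div_sq_add_Ioi_zero {θ : ℝ} (hθ : 0 < θ) :
    (fun w : ℝ => θ / (w ^ 2 + θ)) '' Set.Ioi 0 = Set.Ioo 0 1 := by
  ext t
  constructor
  · rintro ⟨w, hw, rfl⟩
    have hw' : (0 : ℝ) < w := hw
    exact ⟨by positivity, by rw [div_lt_one (by positivity)]; nlinarith⟩
  · rintro ⟨h0, h1⟩
    have h2 : 0 < θ / t - θ := by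
      rw [sub_pos, lt_div_iff₀ h0]; nlinarith
    refine ⟨√(θ / t - θ), Real.sqrt_pos.2 h2, ?_⟩
    simp only [Real.sq_sqrt h2.le]
    field_simp
    ring

/-- Substitute `t = θ / (w² + θ)` in the beta integral; the half-integer powers are carried by the
square roots `√(w² + θ)` and `√θ`. -/
theorem integral_Ioi_zero_eq_zZero {θ : ℝ} (hθ : 0 < θ) {l : ℕ} (hl : 1 ≤ l) :
    ∫ w in Set.Ioi (0 : ℝ), (θ / (w ^ 2 + θ)) ^ l = zZero θ 4 l := by
  have hl' : (1 : ℝ) ≤ l := by exact_mod_cast hl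
  have hb : (0 : ℝ) < l - 2 / 4 := by linarith
  have hint : ∫ t in Set.Ioo (0 : ℝ) 1, t ^ ((l : ℝ) - 2 / 4 - 1) * (1 - t) ^ ((2 / 4 : ℝ) - 1) =
      ∫ w in Set.Ioi (0 : ℝ), 2 / √θ * (θ / (w ^ 2 + θ)) ^ l := by
    rw [← image_div_sq_add_Ioi_zero hθ, integral_image_eq_integral_abs_deriv_smul
      (f' := fun w => -(θ * (2 * w)) / (w ^ 2 + θ) ^ 2) measurableSet_Ioi]
    · refine setIntegral_congr_fun measurableSet_Ioi fun w hw => ?_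
      have hw0 : (0 : ℝ) < w := hw
      have hs : 0 < √(w ^ 2 + θ) := by positivity
      have hs2 : √(w ^ 2 + θ) ^ 2 = w ^ 2 + θ := Real.sq_sqrt (by positivity)
      have ht : 0 < √θ := by positivity
      have ht2 : √θ ^ 2 = θ := Real.sq_sqrt hθ.le
      have e1 : (θ / (w ^ 2 + θ)) ^ ((l : ℝ) - 2 / 4 - 1) =
          (θ / (w ^ 2 + θ)) ^ l * (√(w ^ 2 + θ) / √θ) ^ 3 := by
        have hx : 0 < θ / (w ^ 2 + θ) := by positivity
        have hq : √(w ^ 2 + θ) / √θ = (θ / (w ^ 2 + θ)) ^ (-(1 / 2) : ℝ) := by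
          rw [Real.rpow_neg hx.le, ← Real.sqrt_eq_rpow, Real.sqrt_div hθ.le, inv_div]
        rw [hq, ← Real.rpow_natCast _ l, ← Real.rpow_natCast _ 3, ← Real.rpow_mul hx.le, ← Real.rpow_add hx]
        congr 1
        push_cast
        ring
      have e2 : (1 - θ / (w ^ 2 + θ)) ^ ((2 / 4 : ℝ) - 1) = √(w ^ 2 + θ) / w := by
        have : 1 - θ / (w ^ 2 + θ) = w ^ 2 / (w ^ 2 + θ) := by field_simp; ring
        rw [this, show (2 / 4 : ℝ) - 1 = -(1 / 2) by norm_num, Real.rpow_neg (by positivity),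
          ← Real.sqrt_eq_rpow, Real.sqrt_div (by positivity), Real.sqrt_sq hw0.le, inv_div]
      have e3 : |-(θ * (2 * w)) / (w ^ 2 + θ) ^ 2| = θ * (2 * w) / (w ^ 2 + θ) ^ 2 := by
        rw [neg_div, abs_neg, abs_of_pos (by positivity)]
      simp only [e1, e2, e3, smul_eq_mul]
      generalize (θ / (w ^ 2 + θ)) ^ l = u
      rw [show θ * (2 * w) / (w ^ 2 + θ) ^ 2 = √θ ^ 2 * (2 * w) / (√(w ^ 2 + θ) ^ 2) ^ 2 by
        rw [hs2, ht2]]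
      field_simp
    · intro w hw
      have h := ((hasDerivAt_const w θ).div ((hasDerivAt_pow 2 w).add_const θ)
        (by positivity)).hasDerivWithinAt (s := Set.Ioi 0)
      exact h.congr_deriv (by simp)
    · intro a ha b hb hab
      have ha' : (0 : ℝ) < a := ha
      have hb' : (0 : ℝ) < b := hb
      have h1 : θ / (a ^ 2 + θ) = θ / (b ^ 2 + θ) := hab
      rw [div_eq_div_iff (by positivity) (by positivity)] at h1
      have : a ^ 2 = b ^ 2 := by
        have := mul_left_cancel₀ hθ.ne' h1
        linarith
      exact (pow_left_inj₀ (by linarith) (by linarith) two_ne_zero).1 this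
  have hbeta : beta (2 / 4) ((l : ℝ) - 2 / 4) = beta (l - 2 / 4) (2 / 4) := by
    rw [beta, beta, mul_comm, add_comm]
  rw [zZero, hbeta, ← integral_beta hb (by norm_num), integral_Ioc_eq_integral_Ioo, hint,
    integral_const_mul, show (2 / 4 : ℝ) = 1 / 2 by norm_num, ← Real.sqrt_eq_rpow]
  have ht : 0 < √θ := by positivity
  field_simp
  norm_num

/-! ### Comparison of `zZero` with its large-`l` approximation -/

theorem zZero_four_eq (θ : ℝ) (l : ℕ) :
    zZero θ 4 l = √θ / 2 * √Real.pi * (Real.Gamma (l - 1 / 2) / Real.Gamma l) := by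
  rw [zZero, beta, show (2 / 4 : ℝ) = 1 / 2 by norm_num, add_sub_cancel, Real.Gamma_one_half_eq,
    ← Real.sqrt_eq_rpow]
  ring

theorem Gamma_midpoint_sq_le {x y : ℝ} (hx : 0 < x) (hy : 0 < y) :
    Real.Gamma ((x + y) / 2) ^ 2 ≤ Real.Gamma x * Real.Gamma y := by
  have h := Real.Gamma_mul_add_mul_le_rpow_Gamma_mul_rpow_Gamma hx hy
    (show (0 : ℝ) < 1 / 2 by norm_num) (show (0 : ℝ) < 1 / 2 by norm_num) (by norm_num)
  have h1 := Real.Gamma_pos_of_pos hx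
  have h2 := Real.Gamma_pos_of_pos hy
  rw [← Real.sqrt_eq_rpow, ← Real.sqrt_eq_rpow, ← Real.sqrt_mul h1.le] at h
  rw [show (x + y) / 2 = 1 / 2 * x + 1 / 2 * y by ring, ← Real.sq_sqrt (mul_pos h1 h2).le]
  exact pow_le_pow_left₀ (Real.Gamma_pos_of_pos (by positivity)).le h 2

theorem zZeroApprox_eq (θ : ℝ) (l : ℕ) :
    zZeroApprox θ l = √θ / 2 * √Real.pi * (1 / √l) := by
  rw [zZeroApprox, Real.sqrt_div Real.pi_pos.le]
  ring

/-- Log-convexity at `l - 1/2` and `l + 1/2` gives `Γ(l)² ≤ (l - 1/2) Γ(l - 1/2)² ≤ l Γ(l - 1/2)²`.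
-/
theorem zZeroApprox_le_zZero (θ : ℝ) {l : ℕ} (hl : 1 ≤ l) :
    zZeroApprox θ l ≤ zZero θ 4 l := by
  have hl' : (1 : ℝ) ≤ l := by exact_mod_cast hl
  rw [zZeroApprox_eq, zZero_four_eq]
  refine mul_le_mul_of_nonneg_left ?_ (by positivity)
  have h0 : (0 : ℝ) < l - 1 / 2 := by linarith
  have hG := Real.Gamma_pos_of_pos (show (0 : ℝ) < l by linarith)
  have hG' := Real.Gamma_pos_of_pos h0
  have h := Gamma_midpoint_sq_le h0 (show (0 : ℝ) < (l - 1 / 2) + 1 by linarith)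
  rw [Real.Gamma_add_one h0.ne', show ((l : ℝ) - 1 / 2 + (l - 1 / 2 + 1)) / 2 = l by ring] at h
  rw [div_le_div_iff₀ (by positivity) hG, one_mul]
  refine (pow_le_pow_iff_left₀ hG.le (by positivity) two_ne_zero).1 (h.trans ?_)
  rw [mul_pow, Real.sq_sqrt (by positivity)]
  nlinarith [sq_nonneg (Real.Gamma (l - 1 / 2))]

/-- Log-convexity at `l - 1` and `l` gives `Γ(l - 1/2)² ≤ Γ(l)² / (l - 1)`, and `1/(l - 1) ≤ (1 +
1/l)² / l` amounts to `l + 1 ≤ l²`, true from `l = 2` on. -/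
theorem zZero_le_zZeroApprox (θ : ℝ) {l : ℕ} (hl : 1 ≤ l) :
    zZero θ 4 l ≤ (1 + 1 / (l : ℝ)) * zZeroApprox θ l := by
  rw [zZeroApprox_eq, zZero_four_eq, mul_left_comm]
  refine mul_le_mul_of_nonneg_left ?_ (by positivity)
  rcases hl.eq_or_lt with rfl | hl2
  -- For `l = 1` the point `l - 1` is a pole of `Γ`; the claim reduces to `√π ≤ 2`.
  · norm_num
    rw [Real.Gamma_one_half_eq]
    exact Real.sqrt_le_iff.2 ⟨by norm_num, by linarith [Real.pi_lt_four]⟩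
  · have hl' : (2 : ℝ) ≤ l := by exact_mod_cast hl2
    have h0 : (0 : ℝ) < l - 1 := by linarith
    have hG := Real.Gamma_pos_of_pos (show (0 : ℝ) < l by linarith)
    have hG' := Real.Gamma_pos_of_pos (show (0 : ℝ) < l - 1 / 2 by linarith)
    have h := Gamma_midpoint_sq_le h0 (show (0 : ℝ) < l by linarith)
    have hrec : Real.Gamma l = (l - 1) * Real.Gamma (l - 1) := by
      rw [← Real.Gamma_add_one h0.ne', sub_add_cancel]
    rw [show ((l : ℝ) - 1 + l) / 2 = l - 1 / 2 by ring] at h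
    have hG1 : Real.Gamma ((l : ℝ) - 1) = Real.Gamma l / (l - 1) := by
      rw [hrec]; field_simp
    rw [hG1] at h
    have hs : 0 < √(l : ℝ) := Real.sqrt_pos.2 (by linarith)
    refine (pow_le_pow_iff_left₀ (by positivity) (by positivity) two_ne_zero).1 ?_
    rw [div_pow, mul_pow, div_pow, Real.sq_sqrt (by positivity)]
    have h3 : Real.Gamma (l - 1 / 2) ^ 2 / Real.Gamma l ^ 2 ≤ 1 / (l - 1) := by
      rw [div_le_div_iff₀ (by positivity) h0]
      have := mul_le_mul_of_nonneg_right h h0.le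
      refine this.trans (le_of_eq ?_)
      field_simp
    refine h3.trans ?_
    rw [show (1 + 1 / (l : ℝ)) ^ 2 * (1 ^ 2 / l) = (l + 1) ^ 2 / l ^ 3 by field_simp,
      div_le_div_iff₀ h0 (by positivity)]
    nlinarith

theorem isEquivalent_zZero (θ : ℝ) :
    Asymptotics.IsEquivalent Filter.atTop (fun l : ℕ => zZero θ 4 l) (zZeroApprox θ) := by
  have ho : Filter.Tendsto (fun l : ℕ => 1 / (l : ℝ)) Filter.atTop (nhds 0) :=
    tendsto_one_div_atTop_nhds_zero_nat
  have hlo : (fun l : ℕ => 1 / (l : ℝ) * zZeroApprox θ l) =o[Filter.atTop] zZeroApprox θ := by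
    simpa using ((Asymptotics.isLittleO_one_iff ℝ).2 ho).mul_isBigO
      (Asymptotics.isBigO_refl (zZeroApprox θ) Filter.atTop)
  refine Asymptotics.IsBigO.trans_isLittleO (Asymptotics.IsBigO.of_bound 1 ?_) hlo
  filter_upwards [Filter.eventually_ge_atTop 1] with l hl
  have h1 := zZeroApprox_le_zZero θ hl
  have h2 := zZero_le_zZeroApprox θ hl
  rw [one_mul, Pi.sub_apply, Real.norm_of_nonneg (by linarith)]
  refine le_trans ?_ (le_abs_self _)
  linarith

/-! ### Inclusion–exclusion, positivity of the denominators, and the error bound -/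

/-- Used at two levels: inside each denominator, with `u` a function under the integral, and for the
union over bands, with `u` the conditional coverage probability of one band. -/
theorem sum_choose_mul_neg_one_pow (k : ℕ) (u : ℝ) :
    ∑ l ∈ Finset.Icc 1 k, (k.choose l : ℝ) * (-1) ^ (l + 1) * u ^ l = 1 - (1 - u) ^ k := by
  have h := add_pow (-u) 1 k
  rw [Finset.range_eq_Ico, Finset.sum_eq_sum_Ico_succ_bot (by omega)] at h
  rw [show 1 - u = -u + 1 by ring, h, ← Finset.Ico_succ_right_eq_Icc]
  simp only [pow_zero, one_pow, mul_one, Nat.choose_zero_right, Nat.cast_one, zero_add,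
    Order.succ_eq_add_one, sub_add_cancel_left, ← Finset.sum_neg_distrib]
  refine Finset.sum_congr rfl fun l _ => ?_
  rw [neg_pow u l]
  ring

theorem integrable_one_sub_pow {θ : ℝ} (hθ : 0 < θ) (k : ℕ) :
    Integrable (fun w : ℝ => 1 - (1 - θ / (w ^ 2 + θ)) ^ k) := by
  simp_rw [← sum_choose_mul_neg_one_pow]
  refine integrable_finsetSum _ fun l hl => ?_
  exact (integrableOn_div_sq_add_pow hθ (Finset.mem_Icc.1 hl).1).const_mul _

theorem setIntegral_one_sub_pow {θ : ℝ} (hθ : 0 < θ) (k : ℕ) (s : Set ℝ) :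
    ∫ w in s, (1 - (1 - θ / (w ^ 2 + θ)) ^ k) = ∑ l ∈ Finset.Icc 1 k,
      (k.choose l : ℝ) * (-1) ^ (l + 1) * ∫ w in s, (θ / (w ^ 2 + θ)) ^ l := by
  simp_rw [← sum_choose_mul_neg_one_pow]
  rw [integral_finsetSum]
  · simp_rw [integral_const_mul]
  · intro l hl
    exact ((integrableOn_div_sq_add_pow hθ (Finset.mem_Icc.1 hl).1).const_mul _).integrableOn

theorem one_sub_pow_nonneg {θ : ℝ} (hθ : 0 < θ) (k : ℕ) (w : ℝ) :
    0 ≤ 1 - (1 - θ / (w ^ 2 + θ)) ^ k := by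
  have h3 : 0 ≤ θ / (w ^ 2 + θ) := by positivity
  have h4 : θ / (w ^ 2 + θ) ≤ 1 := by rw [div_le_one (by positivity)]; nlinarith [sq_nonneg w]
  linarith [pow_le_one₀ (n := k) (by linarith) (show 1 - θ / (w ^ 2 + θ) ≤ 1 by linarith)]

section

variable {ι : Type*} [Fintype ι] [DecidableEq ι]

theorem coverageDenominator_eq (lam : ι → ℝ) (n : ι) (θ : ℝ) (z : ℕ → ℝ) (k : ℕ) :
    coverageDenominator lam n θ z k =
      1 + ∑ l ∈ Finset.Icc 1 k, (k.choose l : ℝ) * (-1) ^ (l + 1) * zFar θ 4 l +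
        ∑ j ∈ Finset.univ.erase n, lam j / lam n *
          ∑ l ∈ Finset.Icc 1 k, (k.choose l : ℝ) * (-1) ^ (l + 1) * z l := by
  rw [coverageDenominator, ← Finset.sum_mul]
  simp_rw [← Finset.sum_mul, mul_add, Finset.sum_add_distrib, Finset.mul_sum]
  rw [add_assoc]
  congr 2
  exact Finset.sum_congr rfl fun l _ => by ring

theorem sum_choose_mul_zFar {θ : ℝ} (hθ : 0 < θ) (k : ℕ) :
    ∑ l ∈ Finset.Icc 1 k, (k.choose l : ℝ) * (-1) ^ (l + 1) * zFar θ 4 l =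
      ∫ w in Set.Ioi (1 : ℝ), (1 - (1 - θ / (w ^ 2 + θ)) ^ k) := by
  rw [setIntegral_one_sub_pow hθ]
  exact Finset.sum_congr rfl fun l hl => by
    rw [integral_Ioi_one_eq_zFar hθ (Finset.mem_Icc.1 hl).1]

theorem coverageDenominator_zZero {lam : ι → ℝ} (n : ι) {θ : ℝ} (hθ : 0 < θ) (k : ℕ) :
    coverageDenominator lam n θ (zZero θ 4) k =
      1 + (∫ w in Set.Ioi (1 : ℝ), (1 - (1 - θ / (w ^ 2 + θ)) ^ k)) +
        ∑ j ∈ Finset.univ.erase n, lam j / lam n *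
          ∫ w in Set.Ioi (0 : ℝ), (1 - (1 - θ / (w ^ 2 + θ)) ^ k) := by
  rw [coverageDenominator_eq, sum_choose_mul_zFar hθ, setIntegral_one_sub_pow hθ k (Set.Ioi 0)]
  congr 1
  refine Finset.sum_congr rfl fun j _ => ?_
  congr 1
  exact Finset.sum_congr rfl fun l hl => by
    rw [integral_Ioi_zero_eq_zZero hθ (Finset.mem_Icc.1 hl).1]

theorem one_le_coverageDenominator {lam : ι → ℝ} (hlam : ∀ j, 0 < lam j) (n : ι) {θ : ℝ}
    (hθ : 0 < θ) {z : ℕ → ℝ} {k : ℕ}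
    (hz : 0 ≤ ∑ l ∈ Finset.Icc 1 k, (k.choose l : ℝ) * (-1) ^ (l + 1) * z l) :
    1 ≤ coverageDenominator lam n θ z k := by
  rw [coverageDenominator_eq, sum_choose_mul_zFar hθ]
  have h1 : 0 ≤ ∫ w in Set.Ioi (1 : ℝ), (1 - (1 - θ / (w ^ 2 + θ)) ^ k) :=
    integral_nonneg fun w => one_sub_pow_nonneg hθ k w
  have h2 : 0 ≤ ∑ j ∈ Finset.univ.erase n, lam j / lam n *
      ∑ l ∈ Finset.Icc 1 k, (k.choose l : ℝ) * (-1) ^ (l + 1) * z l :=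
    Finset.sum_nonneg fun j _ => mul_nonneg (div_pos (hlam j) (hlam n)).le hz
  linarith

theorem sum_choose_mul_zZero_nonneg {θ : ℝ} (hθ : 0 < θ) (k : ℕ) :
    0 ≤ ∑ l ∈ Finset.Icc 1 k, (k.choose l : ℝ) * (-1) ^ (l + 1) * zZero θ 4 l := by
  have h := setIntegral_one_sub_pow hθ k (Set.Ioi 0)
  have e : ∑ l ∈ Finset.Icc 1 k, (k.choose l : ℝ) * (-1) ^ (l + 1) * zZero θ 4 l =
      ∑ l ∈ Finset.Icc 1 k, (k.choose l : ℝ) * (-1) ^ (l + 1) *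
        ∫ w in Set.Ioi (0 : ℝ), (θ / (w ^ 2 + θ)) ^ l :=
    Finset.sum_congr rfl fun l hl => by
      rw [integral_Ioi_zero_eq_zZero hθ (Finset.mem_Icc.1 hl).1]
  rw [e, ← h]
  exact integral_nonneg fun w => one_sub_pow_nonneg hθ k w

/-- The approximate coefficients are also moments of a positive measure: `√(π / l) = ∫ t^(-1/2) exp
(-t)^l dt` over `t > 0`. Hence the alternating sum integrates the nonnegative function `1 - (1 - exp
(-t))^k`. -/
theorem sum_choose_mul_zZeroApprox_nonneg (θ : ℝ) (k : ℕ) :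
    0 ≤ ∑ l ∈ Finset.Icc 1 k, (k.choose l : ℝ) * (-1) ^ (l + 1) * zZeroApprox θ l := by
  have key : ∀ l : ℕ, 1 ≤ l → zZeroApprox θ l =
      √θ / 2 * ∫ t in Set.Ioi (0 : ℝ), t ^ ((1 / 2 : ℝ) - 1) * Real.exp (-t) ^ l := by
    intro l hl
    have hl' : (0 : ℝ) < l := by exact_mod_cast hl
    have h := Real.integral_rpow_mul_exp_neg_mul_Ioi (show (0 : ℝ) < 1 / 2 by norm_num) hl'
    rw [Real.Gamma_one_half_eq, ← Real.sqrt_eq_rpow] at h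
    have e : ∀ t : ℝ, Real.exp (-t) ^ l = Real.exp (-(l * t)) := fun t => by
      rw [← Real.exp_nat_mul]; congr 1; ring
    simp_rw [e, h, zZeroApprox_eq]
    rw [Real.sqrt_div zero_le_one, Real.sqrt_one]
    ring
  have hint : ∀ l : ℕ, 1 ≤ l →
      IntegrableOn (fun t : ℝ => t ^ ((1 / 2 : ℝ) - 1) * Real.exp (-t) ^ l) (Set.Ioi 0) := by
    intro l hl
    have hl' : (0 : ℝ) < l := by exact_mod_cast hl
    -- The integral of a non-integrable function is zero by convention, so the nonzero closed form
    -- already forces integrability.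
    refine Integrable.of_integral_ne_zero ?_
    have h := Real.integral_rpow_mul_exp_neg_mul_Ioi (show (0 : ℝ) < 1 / 2 by norm_num) hl'
    have e : ∀ t : ℝ, Real.exp (-t) ^ l = Real.exp (-(l * t)) := fun t => by
      rw [← Real.exp_nat_mul]; congr 1; ring
    simp_rw [e, h]
    have := Real.Gamma_pos_of_pos (show (0 : ℝ) < 1 / 2 by norm_num)
    positivity
  have hsum : ∑ l ∈ Finset.Icc 1 k, (k.choose l : ℝ) * (-1) ^ (l + 1) * zZeroApprox θ l =
      √θ / 2 * ∫ t in Set.Ioi (0 : ℝ), t ^ ((1 / 2 : ℝ) - 1) * (1 - (1 - Real.exp (-t)) ^ k) := by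
    simp_rw [← sum_choose_mul_neg_one_pow, Finset.mul_sum]
    rw [integral_finsetSum, Finset.mul_sum]
    · refine Finset.sum_congr rfl fun l hl => ?_
      rw [key l (Finset.mem_Icc.1 hl).1]
      simp_rw [mul_left_comm _ ((k.choose l : ℝ) * (-1) ^ (l + 1)), integral_const_mul]
      ring
    · intro l hl
      simp_rw [mul_left_comm _ ((k.choose l : ℝ) * (-1) ^ (l + 1))]
      exact (hint l (Finset.mem_Icc.1 hl).1).const_mul _
  rw [hsum]
  refine mul_nonneg (by positivity) (setIntegral_nonneg measurableSet_Ioi fun t ht => ?_)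
  have ht' : (0 : ℝ) < t := ht
  have h1 : Real.exp (-t) ≤ 1 := Real.exp_le_one_iff.2 (by linarith)
  have h2 := Real.exp_pos (-t)
  refine mul_nonneg (by positivity) ?_
  linarith [pow_le_one₀ (n := k) (by linarith) (show 1 - Real.exp (-t) ≤ 1 by linarith)]

theorem abs_coverageForm_sub_le {lam : ι → ℝ} (hlam : ∀ j, 0 < lam j) (n : ι) {θ : ℝ}
    (hθ : 0 < θ) :
    |coverageForm lam n θ (zZero θ 4) - coverageForm lam n θ (zZeroApprox θ)| ≤
      ∑ k ∈ Finset.Icc 1 (Fintype.card ι), ((Fintype.card ι).choose k : ℝ) /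
          (coverageDenominator lam n θ (zZero θ 4) k *
            coverageDenominator lam n θ (zZeroApprox θ) k) *
        ∑ l ∈ Finset.Icc 1 k, (k.choose l : ℝ) *
          ∑ j ∈ Finset.univ.erase n, lam j / lam n * (zZeroApprox θ l / l) := by
  rw [coverageForm, coverageForm, ← Finset.sum_sub_distrib]
  refine (Finset.abs_sum_le_sum_abs _ _).trans (Finset.sum_le_sum fun k _ => ?_)
  have hD : 1 ≤ coverageDenominator lam n θ (zZero θ 4) k :=
    one_le_coverageDenominator hlam n hθ (sum_choose_mul_zZero_nonneg hθ k)
  have hD' : 1 ≤ coverageDenominator lam n θ (zZeroApprox θ) k :=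
    one_le_coverageDenominator hlam n hθ (sum_choose_mul_zZeroApprox_nonneg θ k)
  set D := coverageDenominator lam n θ (zZero θ 4) k with hDd
  set D' := coverageDenominator lam n θ (zZeroApprox θ) k with hDd'
  -- The `zFar` parts cancel, and each remaining coefficient differs by at most `zZeroApprox θ l /
  -- l`, by the two-sided bound.
  have hdiff : |D' - D| ≤ ∑ l ∈ Finset.Icc 1 k, (k.choose l : ℝ) *
      ∑ j ∈ Finset.univ.erase n, lam j / lam n * (zZeroApprox θ l / l) := by
    rw [hDd, hDd', coverageDenominator, coverageDenominator, add_sub_add_left_eq_sub,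
      ← Finset.sum_sub_distrib]
    refine (Finset.abs_sum_le_sum_abs _ _).trans (Finset.sum_le_sum fun l hl => ?_)
    have hl1 := (Finset.mem_Icc.1 hl).1
    rw [← mul_sub, add_sub_add_left_eq_sub, ← Finset.sum_sub_distrib, abs_mul, abs_mul, abs_pow,
      abs_neg, abs_one, one_pow, mul_one, Nat.abs_cast]
    refine mul_le_mul_of_nonneg_left ((Finset.abs_sum_le_sum_abs _ _).trans
      (Finset.sum_le_sum fun j _ => ?_)) (by positivity)
    have hr := div_pos (hlam j) (hlam n)
    rw [← mul_sub, abs_mul, abs_of_pos hr]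
    refine mul_le_mul_of_nonneg_left ?_ hr.le
    have h1 := zZeroApprox_le_zZero θ hl1
    have h2 := zZero_le_zZeroApprox θ hl1
    rw [abs_sub_comm, abs_of_nonneg (by linarith), div_eq_inv_mul, ← one_div]
    linarith
  have e : ((Fintype.card ι).choose k : ℝ) * (-1) ^ (k + 1) / D -
      ((Fintype.card ι).choose k : ℝ) * (-1) ^ (k + 1) / D' =
      (-1) ^ (k + 1) * (((Fintype.card ι).choose k : ℝ) / (D * D') * (D' - D)) := by
    have : D ≠ 0 := by linarith
    have : D' ≠ 0 := by linarith
    field_simp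
  have hc : 0 ≤ ((Fintype.card ι).choose k : ℝ) / (D * D') := by
    have : 0 < D * D' := by nlinarith
    positivity
  rw [e, abs_mul, abs_pow, abs_neg, abs_one, one_pow, one_mul, abs_mul, abs_of_nonneg hc]
  exact mul_le_mul_of_nonneg_left hdiff hc

end

/-! ### The exponential on `[0, ∞]` -/

/-- `exp (-x)` for `x ∈ [0, ∞]`, with `exp (-∞) = 0`. -/
noncomputable def expNeg (x : ℝ≥0∞) : ℝ≥0∞ := EReal.exp (-(x : EReal))

theorem expNeg_zero : expNeg 0 = 1 := by simp [expNeg]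

theorem expNeg_top : expNeg ∞ = 0 := by simp [expNeg]

theorem expNeg_ofReal {x : ℝ} (hx : 0 ≤ x) :
    expNeg (ENNReal.ofReal x) = ENNReal.ofReal (Real.exp (-x)) := by
  rw [expNeg, EReal.coe_ennreal_ofReal, max_eq_left hx, ← EReal.coe_neg, EReal.exp_coe]

theorem expNeg_antitone : Antitone expNeg := fun x y h => by
  rw [expNeg, expNeg, EReal.exp_le_exp_iff, EReal.neg_le_neg_iff]
  exact_mod_cast h

theorem continuous_expNeg : Continuous expNeg :=
  ENNReal.continuous_exp.comp (continuous_neg.comp continuous_coe_ennreal_ereal)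

theorem measurable_expNeg : Measurable expNeg := continuous_expNeg.measurable

theorem expNeg_le_one (x : ℝ≥0∞) : expNeg x ≤ 1 := by
  rw [← expNeg_zero]; exact expNeg_antitone bot_le

theorem expNeg_ne_top (x : ℝ≥0∞) : expNeg x ≠ ∞ :=
  ((expNeg_le_one x).trans_lt ENNReal.one_lt_top).ne

theorem expNeg_add (x y : ℝ≥0∞) : expNeg (x + y) = expNeg x * expNeg y := by
  rw [expNeg, expNeg, expNeg, ← EReal.exp_add, EReal.coe_ennreal_add, EReal.neg_add, sub_eq_add_neg]
  all_goals simp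

theorem expNeg_sum {κ : Type*} (s : Finset κ) (f : κ → ℝ≥0∞) :
    expNeg (∑ i ∈ s, f i) = ∏ i ∈ s, expNeg (f i) := by
  classical
  induction s using Finset.induction_on with
  | empty => simp [expNeg_zero]
  | insert a s ha ih => rw [Finset.sum_insert ha, Finset.prod_insert ha, expNeg_add, ih]

theorem expNeg_natCast_mul (k : ℕ) (x : ℝ≥0∞) : expNeg (k * x) = expNeg x ^ k := by
  have := expNeg_sum (Finset.range k) (fun _ => x)
  simpa using this

/-! ### The Laplace functional of a Poisson point process -/

section PointProcess

variable {Ω : Type*} [MeasurableSpace Ω] {P : Measure Ω}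

theorem measurable_pointMeasure {X : ℕ → Ω → Plane} (hX : ∀ i, Measurable (X i)) :
    Measurable (pointMeasure X) := by
  refine Measure.measurable_of_measurable_coe _ fun B hB => ?_
  simp_rw [pointMeasure, Measure.sum_apply _ hB]
  refine Measurable.tsum fun i => ?_
  exact (Measure.measurable_coe hB).comp (Measure.measurable_dirac.comp (hX i))

theorem lintegral_pointMeasure {Ω : Type*} (X : ℕ → Ω → Plane) (ω : Ω) {f : Plane → ℝ≥0∞}
    (hf : Measurable f) : ∫⁻ y, f y ∂(pointMeasure X ω) = ∑' i, f (X i ω) := by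
  rw [pointMeasure, lintegral_sum_measure]
  exact tsum_congr fun i => lintegral_dirac' _ hf

theorem lintegral_poissonMeasure_pow (r : NNReal) {q : ℝ≥0∞} (hq : q ≤ 1) :
    ∫⁻ m, q ^ m ∂(poissonMeasure r) = expNeg (r * (1 - q)) := by
  obtain ⟨p, rfl⟩ : ∃ p : NNReal, q = p :=
    ⟨q.toNNReal, (ENNReal.coe_toNNReal (hq.trans_lt ENNReal.one_lt_top).ne).symm⟩
  have hp : p ≤ 1 := by exact_mod_cast hq
  have hp' : (p : ℝ) ≤ 1 := hp
  rw [lintegral_countable']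
  simp_rw [poissonMeasure_singleton]
  have hs : HasSum (fun m : ℕ => Real.exp (-r) * ((r * p : ℝ) ^ m / m.factorial))
      (Real.exp (-r) * Real.exp (r * p)) := by
    rw [Real.exp_eq_exp_ℝ]
    exact (NormedSpace.expSeries_div_hasSum_exp (r * p : ℝ)).mul_left _
  have e : ∀ m : ℕ, (p : ℝ≥0∞) ^ m * ENNReal.ofReal (Real.exp (-r) * r ^ m / m.factorial) =
      ENNReal.ofReal (Real.exp (-r) * ((r * p : ℝ) ^ m / m.factorial)) := by
    intro m
    rw [← ENNReal.ofReal_coe_nnreal, ← ENNReal.ofReal_pow p.coe_nonneg,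
      ← ENNReal.ofReal_mul (by positivity)]
    congr 1
    rw [mul_pow]
    ring
  simp_rw [e]
  rw [← ENNReal.ofReal_tsum_of_nonneg (fun m => by positivity) hs.summable, hs.tsum_eq,
    ← Real.exp_add]
  have h1 : (r : ℝ≥0∞) * (1 - p) = ENNReal.ofReal (r * (1 - p)) := by
    rw [ENNReal.ofReal_mul r.coe_nonneg, ENNReal.ofReal_sub _ p.coe_nonneg]
    simp
  rw [h1, expNeg_ofReal (mul_nonneg r.coe_nonneg (by linarith))]
  congr 2
  ring

variable {lam : ℝ} {X : ℕ → Ω → Plane}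

theorem IsPoissonPointProcess.lintegral_expNeg_mul_count (hX : IsPoissonPointProcess P lam X)
    (a : ℝ≥0∞) {B : Set Plane} (hB : MeasurableSet B) (hB' : volume B ≠ ∞) :
    ∫⁻ ω, expNeg (a * pointMeasure X ω B) ∂P =
      expNeg (ENNReal.ofReal lam * ((1 - expNeg a) * volume B)) := by
  have hm : Measurable fun c : ℝ≥0∞ => expNeg (a * c) :=
    measurable_expNeg.comp (measurable_const_mul a)
  rw [(hX.count_law B hB hB').lintegral_comp hm.aemeasurable,
    lintegral_map hm (measurable_of_countable _)]
  simp_rw [mul_comm a, expNeg_natCast_mul]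
  rw [lintegral_poissonMeasure_pow _ (expNeg_le_one a),
    ENNReal.coe_toNNReal (ENNReal.mul_ne_top ENNReal.ofReal_ne_top hB')]
  congr 1
  ring

theorem IsPoissonPointProcess.iIndepFun_count (hX : IsPoissonPointProcess P lam X) {κ : Type*}
    [Fintype κ] {B : κ → Set Plane} (hB : ∀ i, MeasurableSet (B i))
    (hd : Pairwise (Function.onFun Disjoint B)) :
    iIndepFun (fun i ω => pointMeasure X ω (B i)) P := by
  have e := Fintype.equivFin κ
  have h := hX.count_indep _ (fun i => B (e.symm i)) (fun i => hB _)
    (fun i j hij => hd (e.symm.injective.ne hij))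
  have h2 := h.precomp (g := e) e.injective
  simpa using h2

/-- The integral is a finite combination of counts in the disjoint fibres of `g`, so independence
factors the expectation and each factor is a Poisson generating function. The set `K` keeps the
areas finite, as the law of the counts requires. -/
theorem IsPoissonPointProcess.lintegral_expNeg_simpleFunc (hX : IsPoissonPointProcess P lam X)
    (g : SimpleFunc Plane ℝ≥0∞) {K : Set Plane} (hK : MeasurableSet K) (hK' : volume K ≠ ∞) :
    ∫⁻ ω, expNeg (∫⁻ y in K, g y ∂(pointMeasure X ω)) ∂P =
      expNeg (ENNReal.ofReal lam * ∫⁻ y in K, (1 - expNeg (g y))) := by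
  have hB : ∀ y, MeasurableSet (g ⁻¹' {y} ∩ K) := fun y => (g.measurableSet_fiber y).inter hK
  have hind : iIndepFun (fun (y : g.range) ω => pointMeasure X ω (g ⁻¹' {(y : ℝ≥0∞)} ∩ K)) P := by
    refine hX.iIndepFun_count (fun y => hB y) fun y z hyz => ?_
    refine Disjoint.inter_left _ (Disjoint.inter_right _ ?_)
    exact Disjoint.preimage _ (Set.disjoint_singleton.2 (Subtype.coe_injective.ne hyz))
  have h1 : ∀ ω, expNeg (∫⁻ y in K, g y ∂(pointMeasure X ω)) =
      ∏ y : g.range, expNeg (y * pointMeasure X ω (g ⁻¹' {(y : ℝ≥0∞)} ∩ K)) := by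
    intro ω
    rw [SimpleFunc.lintegral_eq_lintegral, SimpleFunc.lintegral_restrict, expNeg_sum,
      ← Finset.prod_coe_sort]
  have h2 : ∫⁻ y in K, (1 - expNeg (g y)) =
      ∑ y : g.range, (1 - expNeg y) * volume (g ⁻¹' {(y : ℝ≥0∞)} ∩ K) := by
    have := SimpleFunc.lintegral_eq_lintegral (g.map fun y => 1 - expNeg y) (volume.restrict K)
    rw [SimpleFunc.map_lintegral] at this
    simp only [SimpleFunc.coe_map, Function.comp_apply] at this
    rw [this, ← Finset.sum_coe_sort]
    refine Finset.sum_congr rfl fun y _ => ?_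
    rw [Measure.restrict_apply (g.measurableSet_fiber _)]
  simp_rw [h1]
  have hm : ∀ y : g.range, Measurable fun c : ℝ≥0∞ => expNeg (y * c) := fun y =>
    measurable_expNeg.comp (measurable_const_mul _)
  have hm' : ∀ y : g.range, Measurable fun ω => pointMeasure X ω (g ⁻¹' {(y : ℝ≥0∞)} ∩ K) :=
    fun y => (Measure.measurable_coe (hB y)).comp (measurable_pointMeasure hX.measurable_point)
  rw [lintegral_prod_eq_prod_lintegral_of_indepFun Finset.univ
    (fun (y : g.range) ω => expNeg (y * pointMeasure X ω (g ⁻¹' {(y : ℝ≥0∞)} ∩ K)))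
    (hind.comp _ hm) (fun y => (hm y).comp (hm' y)), h2, Finset.mul_sum, expNeg_sum]
  refine Finset.prod_congr rfl fun y _ => ?_
  exact hX.lintegral_expNeg_mul_count _ (hB y)
    ((measure_mono Set.inter_subset_right).trans_lt hK'.lt_top).ne

theorem tendsto_lintegral_expNeg [IsFiniteMeasure P] {κ : Type*} {l : Filter κ}
    [l.IsCountablyGenerated] {F : κ → Ω → ℝ≥0∞} {f : Ω → ℝ≥0∞} (hF : ∀ p, Measurable (F p))
    (hlim : ∀ᵐ ω ∂P, Filter.Tendsto (fun p => F p ω) l (nhds (f ω))) :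
    Filter.Tendsto (fun p => ∫⁻ ω, expNeg (F p ω) ∂P) l (nhds (∫⁻ ω, expNeg (f ω) ∂P)) := by
  refine tendsto_lintegral_filter_of_dominated_convergence (fun _ => 1)
    (.of_forall fun p => measurable_expNeg.comp (hF p))
    (.of_forall fun p => .of_forall fun ω => expNeg_le_one _) (by simp) ?_
  filter_upwards [hlim] with ω hω
  exact (continuous_expNeg.tendsto _).comp hω

/-- The Laplace functional of a homogeneous Poisson point process. -/
theorem IsPoissonPointProcess.lintegral_expNeg_lintegral [IsFiniteMeasure P]
    (hX : IsPoissonPointProcess P lam X) {f : Plane → ℝ≥0∞} (hf : Measurable f) :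
    ∫⁻ ω, expNeg (∫⁻ y, f y ∂(pointMeasure X ω)) ∂P =
      expNeg (ENNReal.ofReal lam * ∫⁻ y, (1 - expNeg (f y))) := by
  let K : ℕ → Set Plane := fun m => Metric.ball 0 m
  have hK : ∀ m, MeasurableSet (K m) := fun m => Metric.isOpen_ball.measurableSet
  have hKmono : Monotone K := fun a b h => Metric.ball_subset_ball (by exact_mod_cast h)
  -- Cutting off to balls and approximating by simple functions increase together to `f`. The limit
  -- may take the value `∞`, which is what later encodes void events.
  let g : ℕ → Plane → ℝ≥0∞ := fun m => (K m).indicator (SimpleFunc.eapprox f m)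
  have hg : ∀ m, Measurable (g m) := fun m => (SimpleFunc.measurable _).indicator (hK m)
  have hgmono : ∀ y, Monotone fun m => g m y := by
    intro y a b hab
    exact (Set.indicator_le_indicator_of_subset (hKmono hab) (fun _ => bot_le) y).trans
      (Set.indicator_le_indicator (SimpleFunc.monotone_eapprox f hab y))
  have hglim : ∀ y, Filter.Tendsto (fun m => g m y) Filter.atTop (nhds (f y)) := by
    intro y
    have h1 : Filter.Tendsto (fun m => SimpleFunc.eapprox f m y) Filter.atTop (nhds (f y)) := by
      rw [← SimpleFunc.iSup_eapprox_apply hf]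
      exact tendsto_atTop_iSup fun a b hab => SimpleFunc.monotone_eapprox f hab y
    refine h1.congr' ?_
    obtain ⟨M, hM⟩ := exists_nat_gt ‖y‖
    filter_upwards [Filter.eventually_ge_atTop M] with m hm
    have : y ∈ K m := by
      simpa [K] using hM.trans_le (by exact_mod_cast hm)
    simp [g, this]
  have hstep : ∀ m, ∫⁻ ω, expNeg (∫⁻ y, g m y ∂(pointMeasure X ω)) ∂P =
      expNeg (ENNReal.ofReal lam * ∫⁻ y, (1 - expNeg (g m y))) := by
    intro m
    have h := hX.lintegral_expNeg_simpleFunc (SimpleFunc.eapprox f m) (hK m)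
      measure_ball_lt_top.ne
    have e : ∀ y, (1 - expNeg (g m y)) =
        (K m).indicator (fun y => 1 - expNeg (SimpleFunc.eapprox f m y)) y := by
      intro y
      by_cases hy : y ∈ K m <;> simp [g, hy, expNeg_zero]
    simp_rw [e, g, lintegral_indicator (hK m)]
    exact h
  have hpm := measurable_pointMeasure hX.measurable_point
  have hL : Filter.Tendsto (fun m => ∫⁻ ω, expNeg (∫⁻ y, g m y ∂(pointMeasure X ω)) ∂P)
      Filter.atTop (nhds (∫⁻ ω, expNeg (∫⁻ y, f y ∂(pointMeasure X ω)) ∂P)) := by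
    refine tendsto_lintegral_expNeg
      (fun m => (Measure.measurable_lintegral (hg m)).comp hpm) (.of_forall fun ω => ?_)
    exact lintegral_tendsto_of_tendsto_of_monotone (fun m => (hg m).aemeasurable)
      (.of_forall hgmono) (.of_forall hglim)
  have hR : Filter.Tendsto (fun m => expNeg (ENNReal.ofReal lam * ∫⁻ y, (1 - expNeg (g m y))))
      Filter.atTop (nhds (expNeg (ENNReal.ofReal lam * ∫⁻ y, (1 - expNeg (f y))))) := by
    refine (continuous_expNeg.tendsto _).comp
      (ENNReal.Tendsto.const_mul ?_ (Or.inr ENNReal.ofReal_ne_top))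
    refine lintegral_tendsto_of_tendsto_of_monotone
      (fun m => (measurable_const.sub (measurable_expNeg.comp (hg m))).aemeasurable)
      (.of_forall fun y a b hab => tsub_le_tsub_left (expNeg_antitone (hgmono y hab)) 1)
      (.of_forall fun y => ?_)
    exact ENNReal.Tendsto.sub tendsto_const_nhds
      ((continuous_expNeg.tendsto _).comp (hglim y)) (Or.inl ENNReal.one_ne_top)
  simp_rw [hstep] at hL
  exact tendsto_nhds_unique hL hR

end PointProcess

/-! ### Squared distances and radial integrals -/

/-- A disc of squared radius `t` has area `π t`, so squared distance turns planar area into `π`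
times Lebesgue measure. This is why squared distances are used throughout. -/
theorem map_norm_sq_volume_plane :
    (volume : Measure Plane).map (fun y => ‖y‖ ^ 2) =
      ENNReal.ofReal Real.pi • volume.restrict (Set.Ioi (0 : ℝ)) := by
  have hm : Measurable fun y : Plane => ‖y‖ ^ 2 := by fun_prop
  have hN : ∀ t : ℝ, volume {y : Plane | ‖y‖ ^ 2 < t} = ENNReal.ofReal Real.pi * ENNReal.ofReal t := by
    intro t
    rcases le_or_gt t 0 with ht | ht
    · have : {y : Plane | ‖y‖ ^ 2 < t} = ∅ :=
        Set.eq_empty_of_forall_notMem fun y (hy : ‖y‖ ^ 2 < t) => by nlinarith [sq_nonneg ‖y‖]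
      rw [this, ENNReal.ofReal_of_nonpos ht]
      simp
    · have : {y : Plane | ‖y‖ ^ 2 < t} = Metric.ball 0 (√t) := by
        ext y
        simp [Real.lt_sqrt (norm_nonneg y)]
      rw [this, EuclideanSpace.volume_ball_fin_two, ← ENNReal.ofReal_pow (Real.sqrt_nonneg t),
        Real.sq_sqrt ht.le, mul_comm]
  -- The half-line is closed at `0` so that it meets a half-open interval in a half-open interval.
  rw [restrict_Ioi_eq_restrict_Ici]
  have : IsLocallyFiniteMeasure (ENNReal.ofReal Real.pi • volume.restrict (Set.Ici (0 : ℝ))) :=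
    ⟨fun x => ⟨Set.Ioo (x - 1) (x + 1), Ioo_mem_nhds (by linarith) (by linarith), by
      rw [Measure.smul_apply, smul_eq_mul]
      exact ENNReal.mul_lt_top ENNReal.ofReal_lt_top
        ((Measure.restrict_apply_le _ _).trans_lt (by simp))⟩⟩
  refine (Measure.ext_of_Ico _ _ fun a b hab => ?_).symm
  rw [Measure.map_apply hm measurableSet_Ico, Measure.smul_apply, smul_eq_mul,
    Measure.restrict_apply measurableSet_Ico]
  have h1 : (fun y : Plane => ‖y‖ ^ 2) ⁻¹' Set.Ico a b =
      {y : Plane | ‖y‖ ^ 2 < b} \ {y : Plane | ‖y‖ ^ 2 < a} := by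
    ext y
    simp [and_comm]
  have h2 : Set.Ico a b ∩ Set.Ici 0 = Set.Ico (max a 0) b := by
    ext y
    simp only [Set.mem_inter_iff, Set.mem_Ico, Set.mem_Ici, max_le_iff]
    tauto
  have h3 : {y : Plane | ‖y‖ ^ 2 < a} ⊆ {y : Plane | ‖y‖ ^ 2 < b} := fun y hy => lt_trans hy hab
  rw [h1, measure_sdiff h3
    (measurableSet_lt hm measurable_const).nullMeasurableSet
    (by rw [hN]; exact ENNReal.mul_ne_top ENNReal.ofReal_ne_top ENNReal.ofReal_ne_top), hN, hN, h2,
    Real.volume_Ico, ENNReal.ofReal_sub _ (le_max_right a 0), ENNReal.mul_sub (by simp)]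
  congr 2
  rcases le_total a 0 with h | h
  · rw [max_eq_right h, ENNReal.ofReal_of_nonpos h, ENNReal.ofReal_zero]
  · rw [max_eq_left h]

theorem lintegral_norm_sq_plane {φ : ℝ → ℝ≥0∞} (hφ : Measurable φ) :
    ∫⁻ y : Plane, φ (‖y‖ ^ 2) = ENNReal.ofReal Real.pi * ∫⁻ v in Set.Ioi (0 : ℝ), φ v := by
  rw [← lintegral_map (f := φ) (g := fun y : Plane => ‖y‖ ^ 2) hφ (by fun_prop),
    map_norm_sq_volume_plane, lintegral_smul_measure, smul_eq_mul]

/-- The loss `log (1 + θ (s / v)²)` that a point at squared distance `v` contributes when the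
serving point is at squared distance `s`. -/
noncomputable def pointLoss (θ s v : ℝ) : ℝ≥0∞ := ENNReal.ofReal (Real.log (1 + θ * (s / v) ^ 2))

theorem measurable_pointLoss (θ s : ℝ) : Measurable (pointLoss θ s) := by
  unfold pointLoss
  fun_prop

theorem pointLoss_mono {θ s t : ℝ} (hθ : 0 < θ) (hs : 0 ≤ s) (hst : s ≤ t) (v : ℝ) :
    pointLoss θ s v ≤ pointLoss θ t v := by
  unfold pointLoss
  have h : (s / v) ^ 2 ≤ (t / v) ^ 2 := by
    rw [div_pow, div_pow]
    gcongr
  gcongr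

theorem continuous_pointLoss {θ : ℝ} (hθ : 0 < θ) (v : ℝ) : Continuous fun s => pointLoss θ s v := by
  unfold pointLoss
  refine ENNReal.continuous_ofReal.comp (Continuous.log (by fun_prop) fun s => ?_)
  positivity

theorem expNeg_mul_pointLoss {θ : ℝ} (hθ : 0 < θ) (k : ℕ) (s v : ℝ) :
    expNeg (k * pointLoss θ s v) = ENNReal.ofReal ((1 + θ * (s / v) ^ 2)⁻¹ ^ k) := by
  have h1 : 0 < 1 + θ * (s / v) ^ 2 := by positivity
  rw [expNeg_natCast_mul, pointLoss, expNeg_ofReal (Real.log_nonneg (by nlinarith [sq_nonneg (s / v)])),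
    Real.exp_neg, Real.exp_log h1, ENNReal.ofReal_pow (by positivity)]

/-- Scaling `v = s w` turns `(1 + θ (s/v)²)⁻¹` into `1 - θ / (w² + θ)`, free of `s`. The result is
linear in `s`, so that averaging over the exponential variable `s` is explicit. -/
theorem lintegral_Ioi_one_sub_expNeg {θ : ℝ} (hθ : 0 < θ) (k : ℕ) {s a : ℝ} (hs : 0 ≤ s)
    (ha : 0 ≤ a) :
    ∫⁻ v in Set.Ioi (s * a), (1 - expNeg (k * pointLoss θ s v)) =
      ENNReal.ofReal (s * ∫ w in Set.Ioi a, (1 - (1 - θ / (w ^ 2 + θ)) ^ k)) := by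
  rcases hs.eq_or_lt with rfl | hs
  · simp [expNeg_mul_pointLoss hθ]
  have h1 : ∀ v ∈ Set.Ioi (s * a), 1 - expNeg (k * pointLoss θ s v) =
      ENNReal.ofReal (1 - (1 - θ / ((s⁻¹ * v) ^ 2 + θ)) ^ k) := by
    intro v hv
    have hv0 : 0 < v := lt_of_le_of_lt (by positivity) hv
    have e : 1 - θ / ((s⁻¹ * v) ^ 2 + θ) = (1 + θ * (s / v) ^ 2)⁻¹ := by
      field_simp
      ring
    rw [expNeg_mul_pointLoss hθ, e, ENNReal.ofReal_sub _ (by positivity), ENNReal.ofReal_one]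
  have hi : IntegrableOn (fun v : ℝ => 1 - (1 - θ / ((s⁻¹ * v) ^ 2 + θ)) ^ k) (Set.Ioi (s * a)) :=
    ((integrable_one_sub_pow hθ k).comp_mul_left' (R := s⁻¹) (by positivity)).integrableOn
  rw [setLIntegral_congr_fun measurableSet_Ioi h1, ← ofReal_integral_eq_lintegral_ofReal hi
    (.of_forall fun v => one_sub_pow_nonneg hθ k _),
    integral_comp_mul_left_Ioi (fun w => 1 - (1 - θ / (w ^ 2 + θ)) ^ k) _ (inv_pos.2 hs),
    inv_inv, inv_mul_cancel_left₀ hs.ne', smul_eq_mul]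

theorem lintegral_plane_one_sub_expNeg {θ : ℝ} (hθ : 0 < θ) (k : ℕ) {s a : ℝ} (hs : 0 ≤ s)
    (ha : 0 ≤ a) :
    ∫⁻ y : Plane, (1 - expNeg ((Set.Ioi (s * a)).indicator (fun v => k * pointLoss θ s v) (‖y‖ ^ 2))) =
      ENNReal.ofReal (Real.pi * (s * ∫ w in Set.Ioi a, (1 - (1 - θ / (w ^ 2 + θ)) ^ k))) := by
  have hm : Measurable fun v => (Set.Ioi (s * a)).indicator (fun v => k * pointLoss θ s v) v :=
    ((measurable_pointLoss θ s).const_mul _).indicator measurableSet_Ioi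
  have e : ∀ v : ℝ, 1 - expNeg ((Set.Ioi (s * a)).indicator (fun v => k * pointLoss θ s v) v) =
      (Set.Ioi (s * a)).indicator (fun v => 1 - expNeg (k * pointLoss θ s v)) v := by
    intro v
    by_cases hv : v ∈ Set.Ioi (s * a) <;> simp [hv, expNeg_zero]
  rw [lintegral_norm_sq_plane (φ := fun v => 1 - expNeg ((Set.Ioi (s * a)).indicator
    (fun v => k * pointLoss θ s v) v)) (measurable_const.sub (measurable_expNeg.comp hm))]
  simp_rw [e]
  rw [setLIntegral_indicator measurableSet_Ioi, Set.inter_eq_left.2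
    (Set.Ioi_subset_Ioi (by positivity)), lintegral_Ioi_one_sub_expNeg hθ k hs ha,
    ENNReal.ofReal_mul Real.pi_pos.le]

/-- Exponential tilting: `exp (-c x)` times the density of rate `r` is `r / (r + c)` times the
density of rate `r + c`. -/
theorem lintegral_expNeg_expMeasure {r c : ℝ} (hr : 0 < r) (hc : 0 ≤ c) :
    ∫⁻ x, expNeg (ENNReal.ofReal (c * x)) ∂(expMeasure r) = ENNReal.ofReal (r / (r + c)) := by
  have h : expMeasure r = volume.withDensity (exponentialPDF r) := rfl
  have hm : Measurable (exponentialPDF r) := (measurable_exponentialPDFReal r).ennreal_ofReal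
  have hm' : Measurable fun x => expNeg (ENNReal.ofReal (c * x)) :=
    measurable_expNeg.comp (by fun_prop)
  rw [h, lintegral_withDensity_eq_lintegral_mul _ hm hm',
    ← mul_one (ENNReal.ofReal (r / (r + c))),
    ← lintegral_exponentialPDF_eq_one (show 0 < r + c by linarith), ← lintegral_const_mul'
      _ _ ENNReal.ofReal_ne_top]
  refine lintegral_congr fun x => ?_
  rw [Pi.mul_apply]
  rcases lt_or_ge x 0 with hx | hx
  · simp [exponentialPDF_of_neg hx]
  · rw [exponentialPDF_of_nonneg hx, exponentialPDF_of_nonneg hx, expNeg_ofReal (by positivity),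
      ← ENNReal.ofReal_mul (by positivity), ← ENNReal.ofReal_mul (by positivity), mul_assoc,
      ← Real.exp_add]
    congr 1
    have : r + c ≠ 0 := by linarith
    field_simp
    congr 1
    ring

/-! ### The law of the nearest distance -/

section Nearest

variable {Ω : Type*} [MeasurableSpace Ω] {P : Measure Ω}

/-- The squared distance from the origin to the nearest point. -/
noncomputable def nearestSq (X : ℕ → Ω → Plane) (ω : Ω) : ℝ := ⨅ i, ‖X i ω‖ ^ 2

theorem nearestSq_nonneg {Ω : Type*} (X : ℕ → Ω → Plane) (ω : Ω) : 0 ≤ nearestSq X ω :=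
  Real.iInf_nonneg fun _ => sq_nonneg _

theorem le_nearestSq_iff {Ω : Type*} (X : ℕ → Ω → Plane) (ω : Ω) (c : ℝ) :
    c ≤ nearestSq X ω ↔ ∀ i, c ≤ ‖X i ω‖ ^ 2 :=
  le_ciInf_iff ⟨0, by rintro _ ⟨i, rfl⟩; exact sq_nonneg _⟩

theorem measurable_nearestSq {X : ℕ → Ω → Plane} (hX : ∀ i, Measurable (X i)) :
    Measurable (nearestSq X) :=
  Measurable.iInf fun i => (hX i).norm.pow_const 2

/-- An infinite weight on the disc kills every configuration that meets it. Void events thereby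
become Laplace functionals and can be combined with other weights. -/
theorem expNeg_lintegral_top_indicator {Ω : Type*} (X : ℕ → Ω → Plane) (ω : Ω) (c : ℝ) :
    expNeg (∫⁻ y, (Set.Iio c).indicator (fun _ => ∞) (‖y‖ ^ 2) ∂(pointMeasure X ω)) =
      {ω | c ≤ nearestSq X ω}.indicator 1 ω := by
  have hm : Measurable fun y : Plane => (Set.Iio c).indicator (fun _ => ∞) (‖y‖ ^ 2) :=
    (measurable_const.indicator measurableSet_Iio).comp
      (by fun_prop : Measurable fun y : Plane => ‖y‖ ^ 2)
  rw [lintegral_pointMeasure X ω hm]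
  by_cases h : c ≤ nearestSq X ω
  · have h' := (le_nearestSq_iff X ω c).1 h
    have : ∀ i, (Set.Iio c).indicator (fun _ => ∞) (‖X i ω‖ ^ 2) = (0 : ℝ≥0∞) := fun i =>
      Set.indicator_of_notMem (by simpa using h' i) _
    simp [this, h, expNeg_zero]
  · have h' := h
    rw [le_nearestSq_iff] at h'
    push Not at h'
    obtain ⟨i, hi⟩ := h'
    have : ∑' i, (Set.Iio c).indicator (fun _ => ∞) (‖X i ω‖ ^ 2) = (∞ : ℝ≥0∞) :=
      ENNReal.tsum_eq_top_of_eq_top ⟨i, Set.indicator_of_mem (by simpa using hi) _⟩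
    simp [this, h, expNeg_top]

theorem IsPoissonPointProcess.measure_le_nearestSq [IsFiniteMeasure P] {lam : ℝ}
    {X : ℕ → Ω → Plane} (hX : IsPoissonPointProcess P lam X) (c : ℝ) :
    P {ω | c ≤ nearestSq X ω} =
      expNeg (ENNReal.ofReal lam * (ENNReal.ofReal Real.pi * ENNReal.ofReal c)) := by
  have hm : Measurable ((Set.Iio c).indicator (fun _ => (∞ : ℝ≥0∞))) :=
    measurable_const.indicator measurableSet_Iio
  have hms : MeasurableSet {ω | c ≤ nearestSq X ω} :=
    measurableSet_le measurable_const (measurable_nearestSq hX.measurable_point)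
  rw [← lintegral_indicator_one hms]
  simp_rw [← expNeg_lintegral_top_indicator X _ c]
  refine (hX.lintegral_expNeg_lintegral
    (hm.comp (by fun_prop : Measurable fun y : Plane => ‖y‖ ^ 2))).trans ?_
  congr 2
  refine (lintegral_norm_sq_plane (φ := fun v => 1 - expNeg ((Set.Iio c).indicator (fun _ => ∞) v))
    (measurable_const.sub (measurable_expNeg.comp hm))).trans ?_
  congr 1
  have e : ∀ v : ℝ, 1 - expNeg ((Set.Iio c).indicator (fun _ => ∞) v) =
      (Set.Iio c).indicator 1 v := by
    intro v
    by_cases hv : v ∈ Set.Iio c <;> simp [hv, expNeg_zero, expNeg_top]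
  simp_rw [e]
  rw [lintegral_indicator_one measurableSet_Iio, Measure.restrict_apply measurableSet_Iio,
    Set.inter_comm, Set.Ioi_inter_Iio, Real.volume_Ioo, sub_zero]

theorem IsPoissonPointProcess.map_nearestSq [IsProbabilityMeasure P] {lam : ℝ} (hlam : 0 < lam)
    {X : ℕ → Ω → Plane} (hX : IsPoissonPointProcess P lam X) :
    P.map (nearestSq X) = expMeasure (lam * Real.pi) := by
  have hr : 0 < lam * Real.pi := mul_pos hlam Real.pi_pos
  have hm := measurable_nearestSq hX.measurable_point
  have := isProbabilityMeasure_expMeasure hr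
  have := Measure.isProbabilityMeasure_map (μ := P) hm.aemeasurable
  refine Measure.ext_of_Ici _ _ fun c => ?_
  rw [Measure.map_apply hm measurableSet_Ici]
  refine (hX.measure_le_nearestSq c).trans ?_
  have hIic : expMeasure (lam * Real.pi) (Set.Iic c) =
      ENNReal.ofReal (if 0 ≤ c then 1 - Real.exp (-(lam * Real.pi * c)) else 0) := by
    rw [← cdf_expMeasure_eq hr, ofReal_cdf]
  have hac : expMeasure (lam * Real.pi) {c} = 0 := by
    have : expMeasure (lam * Real.pi) ≪ volume := withDensity_absolutelyContinuous _ _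
    exact this (by simp)
  have hIci : expMeasure (lam * Real.pi) (Set.Ici c) =
      1 - expMeasure (lam * Real.pi) (Set.Iic c) := by
    rw [← Set.compl_Iio, prob_compl_eq_one_sub measurableSet_Iio,
      measure_congr (Iio_ae_eq_Iic' hac)]
  rw [hIci, hIic]
  split_ifs with h
  · rw [← ENNReal.ofReal_mul Real.pi_pos.le, ← ENNReal.ofReal_mul hlam.le,
      expNeg_ofReal (by positivity), ← mul_assoc, ← ENNReal.ofReal_one, ← ENNReal.ofReal_sub]
    · congr 1
      ring
    · have : Real.exp (-(lam * Real.pi * c)) ≤ 1 := Real.exp_le_one_iff.2 (by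
        have : 0 ≤ lam * Real.pi * c := by positivity
        linarith)
      linarith
  · rw [ENNReal.ofReal_of_nonpos (le_of_not_ge h)]
    simp [expNeg_zero]

end Nearest

/-! ### Losses and dyadic rounding of the serving distance -/

/-- The loss contributed by a point at `y` of the process `j`, when the serving point belongs to
process `n` and is at squared distance `s`; points of process `n` count only if their squared
distance lies in `A`. -/
noncomputable def lossAt {ι : Type*} [DecidableEq ι] (n : ι) (k : ℕ) (θ s : ℝ) (A : Set ℝ) (j : ι)
    (y : Plane) : ℝ≥0∞ :=
  (if j = n then A else Set.Ioi 0).indicator (fun v => k * pointLoss θ s v) (‖y‖ ^ 2)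

theorem measurable_lossAt {ι : Type*} [DecidableEq ι] (n : ι) (k : ℕ) (θ s : ℝ) {A : Set ℝ}
    (hA : MeasurableSet A) (j : ι) : Measurable (lossAt n k θ s A j) := by
  have h : MeasurableSet (if j = n then A else Set.Ioi 0) := by
    split_ifs
    exacts [hA, measurableSet_Ioi]
  exact (((measurable_pointLoss θ s).const_mul _).indicator h).comp
    (by fun_prop : Measurable fun y : Plane => ‖y‖ ^ 2)

theorem lintegral_comp_nat {Ω : Type*} [MeasurableSpace Ω] {P : Measure Ω} {N : Ω → ℕ}
    (hN : Measurable N) {F : ℕ → Ω → ℝ≥0∞} (hF : ∀ m, Measurable (F m)) :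
    ∫⁻ ω, F (N ω) ω ∂P = ∑' m, ∫⁻ ω in N ⁻¹' {m}, F m ω ∂P := by
  have e : ∀ ω, F (N ω) ω = ∑' m, (N ⁻¹' {m}).indicator (F m) ω := by
    intro ω
    rw [tsum_eq_single (N ω) fun m hm => Set.indicator_of_notMem (by simpa using hm.symm) _]
    simp
  simp_rw [e]
  rw [lintegral_tsum fun m => ((hF m).indicator (hN (measurableSet_singleton m))).aemeasurable]
  exact tsum_congr fun m => lintegral_indicator (hN (measurableSet_singleton m)) _

theorem measurable_comp_nat {Ω β : Type*} [MeasurableSpace Ω] [MeasurableSpace β] {N : Ω → ℕ}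
    (hN : Measurable N) {F : ℕ → Ω → β} (hF : ∀ m, Measurable (F m)) :
    Measurable fun ω => F (N ω) ω := by
  have h : Measurable fun q : ℕ × Ω => F q.1 q.2 := measurable_from_prod_countable_right hF
  exact h.comp (hN.prodMk measurable_id)

theorem monotone_floor_mul_two_pow_div {x : ℝ} (hx : 0 ≤ x) :
    Monotone fun p : ℕ => (⌊x * 2 ^ p⌋₊ : ℝ) / 2 ^ p := by
  refine monotone_nat_of_le_succ fun p => ?_
  rw [div_le_div_iff₀ (by positivity) (by positivity), pow_succ, ← mul_assoc, mul_comm _ (2 : ℝ),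
    ← mul_assoc]
  refine mul_le_mul_of_nonneg_right ?_ (by positivity)
  have h : 2 * ⌊x * 2 ^ p⌋₊ ≤ ⌊2 * (x * 2 ^ p)⌋₊ := by
    refine Nat.le_floor ?_
    push_cast
    linarith [Nat.floor_le (show 0 ≤ x * 2 ^ p by positivity)]
  have h' : (2 * ⌊x * 2 ^ p⌋₊ : ℝ) ≤ ⌊2 * (x * 2 ^ p)⌋₊ := by exact_mod_cast h
  rwa [show x * (2 ^ p * 2) = 2 * (x * 2 ^ p) by ring]

theorem antitone_floor_mul_two_pow_add_one_div {x : ℝ} (hx : 0 ≤ x) :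
    Antitone fun p : ℕ => ((⌊x * 2 ^ p⌋₊ : ℝ) + 1) / 2 ^ p := by
  refine antitone_nat_of_succ_le fun p => ?_
  rw [div_le_div_iff₀ (by positivity) (by positivity),
    show ((⌊x * 2 ^ p⌋₊ : ℝ) + 1) * 2 ^ (p + 1) = 2 * (⌊x * 2 ^ p⌋₊ + 1) * 2 ^ p by ring,
    show x * 2 ^ (p + 1) = 2 * (x * 2 ^ p) by ring]
  refine mul_le_mul_of_nonneg_right ?_ (by positivity)
  have h : ⌊2 * (x * 2 ^ p)⌋₊ < 2 * (⌊x * 2 ^ p⌋₊ + 1) := by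
    rw [Nat.floor_lt (show 0 ≤ 2 * (x * 2 ^ p) by positivity)]
    push_cast
    linarith [Nat.lt_floor_add_one (x * 2 ^ p)]
  have h' : (⌊2 * (x * 2 ^ p)⌋₊ + 1 : ℝ) ≤ 2 * (⌊x * 2 ^ p⌋₊ + 1) := by exact_mod_cast h
  exact h'

theorem tendsto_floor_mul_two_pow_div {x : ℝ} (hx : 0 ≤ x) :
    Filter.Tendsto (fun p : ℕ => (⌊x * 2 ^ p⌋₊ : ℝ) / 2 ^ p) Filter.atTop (nhds x) :=
  (tendsto_nat_floor_mul_div_atTop hx).comp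
    (tendsto_pow_atTop_atTop_of_one_lt (one_lt_two : (1 : ℝ) < 2))

theorem tendsto_floor_mul_two_pow_add_one_div {x : ℝ} (hx : 0 ≤ x) :
    Filter.Tendsto (fun p : ℕ => ((⌊x * 2 ^ p⌋₊ : ℝ) + 1) / 2 ^ p) Filter.atTop (nhds x) := by
  have h : Filter.Tendsto (fun p : ℕ => (1 : ℝ) / 2 ^ p) Filter.atTop (nhds 0) := by
    simpa using tendsto_pow_atTop_nhds_zero_of_lt_one (by norm_num : (0 : ℝ) ≤ 2⁻¹) (by norm_num)
  simpa [add_div] using (tendsto_floor_mul_two_pow_div hx).add h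

section

variable {ι : Type*} [DecidableEq ι] (n : ι) (k : ℕ) {θ : ℝ} {x : ℝ}

/-- The serving distance is rounded down and the exclusion radius rounded up. Under refinement one
increases and the other decreases, so losses grow and monotone convergence applies. -/
theorem monotone_lossAt_dyadic (hθ : 0 < θ) (hx : 0 ≤ x) (j : ι) (y : Plane) :
    Monotone fun p : ℕ => lossAt n k θ ((⌊x * 2 ^ p⌋₊ : ℝ) / 2 ^ p)
      (Set.Ici (((⌊x * 2 ^ p⌋₊ : ℝ) + 1) / 2 ^ p)) j y := by
  intro p q hpq
  have h1 := monotone_floor_mul_two_pow_div hx hpq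
  have h2 := antitone_floor_mul_two_pow_add_one_div hx hpq
  have h3 : ∀ v, (k : ℝ≥0∞) * pointLoss θ ((⌊x * 2 ^ p⌋₊ : ℝ) / 2 ^ p) v ≤
      k * pointLoss θ ((⌊x * 2 ^ q⌋₊ : ℝ) / 2 ^ q) v := fun v =>
    mul_le_mul_right (pointLoss_mono hθ (by positivity) h1 v) _
  unfold lossAt
  refine (Set.indicator_le_indicator_of_subset ?_ (fun _ => bot_le) _).trans
    (Set.indicator_le_indicator (h3 _))
  split_ifs
  · exact Set.Ici_subset_Ici.2 h2
  · exact subset_rfl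

theorem tendsto_lossAt_dyadic (hθ : 0 < θ) (hx : 0 ≤ x) (j : ι) (y : Plane) :
    Filter.Tendsto (fun p : ℕ => lossAt n k θ ((⌊x * 2 ^ p⌋₊ : ℝ) / 2 ^ p)
      (Set.Ici (((⌊x * 2 ^ p⌋₊ : ℝ) + 1) / 2 ^ p)) j y) Filter.atTop
      (nhds (lossAt n k θ x (Set.Ioi x) j y)) := by
  have h : Filter.Tendsto
      (fun p : ℕ => (k : ℝ≥0∞) * pointLoss θ ((⌊x * 2 ^ p⌋₊ : ℝ) / 2 ^ p) (‖y‖ ^ 2))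
      Filter.atTop (nhds (k * pointLoss θ x (‖y‖ ^ 2))) :=
    ENNReal.Tendsto.const_mul (((continuous_pointLoss hθ (‖y‖ ^ 2)).tendsto x).comp
      (tendsto_floor_mul_two_pow_div hx)) (Or.inr (ENNReal.natCast_ne_top k))
  unfold lossAt
  by_cases hj : j = n
  · simp only [if_pos hj]
    by_cases hy : x < ‖y‖ ^ 2
    · rw [Set.indicator_of_mem (show ‖y‖ ^ 2 ∈ Set.Ioi x from hy)]
      refine h.congr' ?_
      filter_upwards [(tendsto_floor_mul_two_pow_add_one_div hx).eventually_lt_const hy] with p hp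
      rw [Set.indicator_of_mem (show ‖y‖ ^ 2 ∈ Set.Ici _ from hp.le)]
    · rw [Set.indicator_of_notMem (show ‖y‖ ^ 2 ∉ Set.Ioi x from hy)]
      -- The rounded-up radius is strictly larger than `x`, so points at or below `x`, the serving
      -- one included, are excluded at every stage.
      refine tendsto_const_nhds.congr fun p => ?_
      refine (Set.indicator_of_notMem ?_ _).symm
      rw [Set.mem_Ici, not_le]
      refine (not_lt.1 hy).trans_lt ?_
      rw [lt_div_iff₀ (by positivity)]
      exact Nat.lt_floor_add_one _
  · simp only [if_neg hj]
    by_cases hy : ‖y‖ ^ 2 ∈ Set.Ioi (0 : ℝ)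
    · simpa only [Set.indicator_of_mem hy] using h
    · simpa only [Set.indicator_of_notMem hy] using tendsto_const_nhds

end

/-! ### Moments of the conditional coverage probability of one band -/

section Moments

variable {Ω : Type*} [MeasurableSpace Ω] {P : Measure Ω} {ι : Type*} [Fintype ι] [DecidableEq ι]

/-- The total loss over the points of all processes, see `lossAt`. -/
noncomputable def totalLoss (X : ι → ℕ → Ω → Plane) (n : ι) (k : ℕ) (θ s : ℝ) (A : Set ℝ) (ω : Ω) :
    ℝ≥0∞ :=
  ∑ j, ∫⁻ y, lossAt n k θ s A j y ∂(pointMeasure (X j) ω)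

/-- The exponent in the Laplace transform of `totalLoss` at a deterministic `s`. -/
noncomputable def lossExponent (lam : ι → ℝ) (n : ι) (k : ℕ) (θ s : ℝ) (A : Set ℝ) : ℝ≥0∞ :=
  ∑ j, ENNReal.ofReal (lam j) * ∫⁻ y : Plane, (1 - expNeg (lossAt n k θ s A j y))

theorem totalLoss_eq_mul {Ω : Type*} (X : ι → ℕ → Ω → Plane) (n : ι) (k : ℕ) (θ s : ℝ)
    {A : Set ℝ} (hA : MeasurableSet A) (ω : Ω) :
    totalLoss X n k θ s A ω = k * totalLoss X n 1 θ s A ω := by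
  rw [totalLoss, totalLoss, Finset.mul_sum]
  refine Finset.sum_congr rfl fun j _ => ?_
  rw [← lintegral_const_mul _ (measurable_lossAt n 1 θ s hA j)]
  refine lintegral_congr fun y => ?_
  unfold lossAt Set.indicator
  split_ifs <;> simp

theorem lintegral_expNeg_sum_lintegral {ι : Type*} [Fintype ι] {lam : ι → ℝ} {X : ι → ℕ → Ω → Plane}
    (hX : ∀ j, IsPoissonPointProcess P (lam j) (X j))
    (hind : iIndepFun (fun j ω => pointMeasure (X j) ω) P) {f : ι → Plane → ℝ≥0∞}
    (hf : ∀ j, Measurable (f j)) :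
    ∫⁻ ω, expNeg (∑ j, ∫⁻ y, f j y ∂(pointMeasure (X j) ω)) ∂P =
      expNeg (∑ j, ENNReal.ofReal (lam j) * ∫⁻ y : Plane, (1 - expNeg (f j y))) := by
  have := hind.isProbabilityMeasure
  simp_rw [expNeg_sum]
  have hm : ∀ j, Measurable fun μ : Measure Plane => expNeg (∫⁻ y, f j y ∂μ) := fun j =>
    measurable_expNeg.comp (Measure.measurable_lintegral (hf j))
  rw [lintegral_prod_eq_prod_lintegral_of_indepFun Finset.univ
    (fun j ω => expNeg (∫⁻ y, f j y ∂(pointMeasure (X j) ω))) (hind.comp _ hm)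
    (fun j => (hm j).comp (measurable_pointMeasure (hX j).measurable_point))]
  exact Finset.prod_congr rfl fun j _ => (hX j).lintegral_expNeg_lintegral (hf j)

variable {lam : ι → ℝ} {X : ι → ℕ → Ω → Plane}

theorem measurable_totalLoss (hX : ∀ j, IsPoissonPointProcess P (lam j) (X j)) (n : ι) (k : ℕ)
    (θ s : ℝ) {A : Set ℝ} (hA : MeasurableSet A) : Measurable (totalLoss X n k θ s A) :=
  Finset.measurable_fun_sum _ fun j _ =>
    (Measure.measurable_lintegral (measurable_lossAt n k θ s hA j)).comp
      (measurable_pointMeasure (hX j).measurable_point)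

/-- Independence over disjoint regions: the void event concerns operator `n` below `c`, its loss
only points from `b ≥ c` on. Adding the infinite void weight to the loss makes the left side one
Laplace functional, whose exponent splits because the supports within process `n` are disjoint. -/
theorem setLIntegral_le_nearestSq (hX : ∀ j, IsPoissonPointProcess P (lam j) (X j))
    (hind : iIndepFun (fun j ω => pointMeasure (X j) ω) P) (n : ι) (k : ℕ) (θ s : ℝ) {b c : ℝ}
    (hcb : c ≤ b) :
    ∫⁻ ω in {ω | c ≤ nearestSq (X n) ω}, expNeg (totalLoss X n k θ s (Set.Ici b) ω) ∂P =
      P {ω | c ≤ nearestSq (X n) ω} * expNeg (lossExponent lam n k θ s (Set.Ici b)) := by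
  have := hind.isProbabilityMeasure
  have hms : MeasurableSet {ω | c ≤ nearestSq (X n) ω} :=
    measurableSet_le measurable_const (measurable_nearestSq (hX n).measurable_point)
  let v : Plane → ℝ≥0∞ := fun y => (Set.Iio c).indicator (fun _ => ∞) (‖y‖ ^ 2)
  have hv : Measurable v := (measurable_const.indicator measurableSet_Iio).comp
    (by fun_prop : Measurable fun y : Plane => ‖y‖ ^ 2)
  let f : ι → Plane → ℝ≥0∞ := fun j y => (if j = n then v y else 0) + lossAt n k θ s (Set.Ici b) j y
  have hv' : ∀ j, Measurable fun y => if j = n then v y else 0 := fun j => by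
    split_ifs
    exacts [hv, measurable_const]
  have hl := fun j => measurable_lossAt n k θ s (measurableSet_Ici (a := b)) j
  have hP : P {ω | c ≤ nearestSq (X n) ω} =
      expNeg (ENNReal.ofReal (lam n) * ∫⁻ y : Plane, (1 - expNeg (v y))) := by
    rw [← (hX n).lintegral_expNeg_lintegral hv, ← lintegral_indicator_one hms]
    exact lintegral_congr fun ω => (expNeg_lintegral_top_indicator (X n) ω c).symm
  have h1 : ∀ ω, {ω | c ≤ nearestSq (X n) ω}.indicator
      (fun ω => expNeg (totalLoss X n k θ s (Set.Ici b) ω)) ω =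
      expNeg (∑ j, ∫⁻ y, f j y ∂(pointMeasure (X j) ω)) := by
    intro ω
    have e : ∑ j, ∫⁻ y, f j y ∂(pointMeasure (X j) ω) =
        ∫⁻ y, v y ∂(pointMeasure (X n) ω) + totalLoss X n k θ s (Set.Ici b) ω := by
      rw [totalLoss]
      simp_rw [f, lintegral_add_left (hv' _), Finset.sum_add_distrib]
      congr 1
      rw [Finset.sum_eq_single n (fun j _ hj => by simp [hj]) (by simp)]
      simp
    rw [e, expNeg_add, expNeg_lintegral_top_indicator]
    by_cases h : ω ∈ {ω | c ≤ nearestSq (X n) ω}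
    · simp only [Set.indicator_of_mem h, Pi.one_apply, one_mul]
    · simp only [Set.indicator_of_notMem h, zero_mul]
  rw [← lintegral_indicator hms]
  simp_rw [h1]
  rw [lintegral_expNeg_sum_lintegral hX hind (f := f) fun j => (hv' j).add (hl j), hP, ← expNeg_add]
  congr 1
  have h2 : ∀ j y, 1 - expNeg (f j y) = (1 - expNeg (if j = n then v y else 0)) +
      (1 - expNeg (lossAt n k θ s (Set.Ici b) j y)) := by
    intro j y
    by_cases hj : j = n
    · by_cases hy : ‖y‖ ^ 2 < c
      · have : ‖y‖ ^ 2 ∉ Set.Ici b := by simpa using hy.trans_le hcb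
        simp [f, v, lossAt, hj, hy, this, expNeg_zero, expNeg_top]
      · simp [f, v, hj, hy, expNeg_zero]
    · simp [f, hj, expNeg_zero]
  have hv1 : ∀ j, Measurable fun y => 1 - expNeg (if j = n then v y else 0) := fun j =>
    measurable_const.sub (measurable_expNeg.comp (hv' j))
  rw [lossExponent]
  simp_rw [h2, lintegral_add_left (hv1 _), mul_add, Finset.sum_add_distrib]
  congr 1
  rw [Finset.sum_eq_single n (fun j _ hj => by simp [hj, expNeg_zero]) (by simp)]
  simp

/-- Subtract the void identity at `c = b` from the one at `c = a`, with the same loss region. -/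
theorem setLIntegral_nearestSq_Ico (hX : ∀ j, IsPoissonPointProcess P (lam j) (X j))
    (hind : iIndepFun (fun j ω => pointMeasure (X j) ω) P) (n : ι) (k : ℕ) (θ s : ℝ) {a b : ℝ}
    (hab : a ≤ b) :
    ∫⁻ ω in nearestSq (X n) ⁻¹' Set.Ico a b, expNeg (totalLoss X n k θ s (Set.Ici b) ω) ∂P =
      P (nearestSq (X n) ⁻¹' Set.Ico a b) * expNeg (lossExponent lam n k θ s (Set.Ici b)) := by
  have := hind.isProbabilityMeasure
  have hD := measurable_nearestSq (hX n).measurable_point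
  have hb : MeasurableSet {ω | b ≤ nearestSq (X n) ω} := measurableSet_le measurable_const hD
  have hU : {ω | a ≤ nearestSq (X n) ω} =
      nearestSq (X n) ⁻¹' Set.Ico a b ∪ {ω | b ≤ nearestSq (X n) ω} := by
    ext ω
    simp only [Set.mem_ofPred_eq, Set.mem_union, Set.mem_preimage, Set.mem_Ico]
    constructor
    · intro h
      rcases lt_or_ge (nearestSq (X n) ω) b with h' | h'
      exacts [Or.inl ⟨h, h'⟩, Or.inr h']
    · rintro (h | h)
      exacts [h.1, hab.trans h]
  have hd : Disjoint (nearestSq (X n) ⁻¹' Set.Ico a b) {ω | b ≤ nearestSq (X n) ω} :=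
    Set.disjoint_left.2 fun ω h h' => absurd h.2 (not_lt.2 h')
  have h1 := setLIntegral_le_nearestSq hX hind n k θ s hab
  have h2 := setLIntegral_le_nearestSq hX hind n k θ s le_rfl (b := b)
  rw [hU, lintegral_union hb hd, measure_union hd hb, add_mul, h2] at h1
  -- The subtracted term is finite, which makes cancellation legitimate in `[0, ∞]`.
  exact (ENNReal.add_left_inj
    (ENNReal.mul_ne_top (measure_ne_top _ _) (expNeg_ne_top _))).1 h1

theorem lintegral_expNeg_totalLoss_dyadic (hX : ∀ j, IsPoissonPointProcess P (lam j) (X j))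
    (hind : iIndepFun (fun j ω => pointMeasure (X j) ω) P) (n : ι) (k : ℕ) (θ : ℝ) (p : ℕ) :
    ∫⁻ ω, expNeg (totalLoss X n k θ ((⌊nearestSq (X n) ω * 2 ^ p⌋₊ : ℝ) / 2 ^ p)
      (Set.Ici (((⌊nearestSq (X n) ω * 2 ^ p⌋₊ : ℝ) + 1) / 2 ^ p)) ω) ∂P =
    ∫⁻ ω, expNeg (lossExponent lam n k θ ((⌊nearestSq (X n) ω * 2 ^ p⌋₊ : ℝ) / 2 ^ p)
      (Set.Ici (((⌊nearestSq (X n) ω * 2 ^ p⌋₊ : ℝ) + 1) / 2 ^ p))) ∂P := by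
  have hD := measurable_nearestSq (hX n).measurable_point
  have hN : Measurable fun ω => ⌊nearestSq (X n) ω * 2 ^ p⌋₊ :=
    Nat.measurable_floor.comp (hD.mul_const _)
  rw [lintegral_comp_nat (N := fun ω => ⌊nearestSq (X n) ω * 2 ^ p⌋₊) (F := fun m ω =>
      expNeg (totalLoss X n k θ ((m : ℝ) / 2 ^ p) (Set.Ici (((m : ℝ) + 1) / 2 ^ p)) ω)) hN
      (fun m => measurable_expNeg.comp (measurable_totalLoss hX n k θ _ measurableSet_Ici)),
    lintegral_comp_nat (N := fun ω => ⌊nearestSq (X n) ω * 2 ^ p⌋₊) (F := fun m _ =>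
      expNeg (lossExponent lam n k θ ((m : ℝ) / 2 ^ p) (Set.Ici (((m : ℝ) + 1) / 2 ^ p)))) hN
      (fun m => measurable_const)]
  refine tsum_congr fun m => ?_
  have hs : (fun ω => ⌊nearestSq (X n) ω * 2 ^ p⌋₊) ⁻¹' {m} =
      nearestSq (X n) ⁻¹' Set.Ico ((m : ℝ) / 2 ^ p) (((m : ℝ) + 1) / 2 ^ p) := by
    ext ω
    have h2 : (0 : ℝ) < 2 ^ p := by positivity
    rw [Set.mem_preimage, Set.mem_singleton_iff, Nat.floor_eq_iff
      (mul_nonneg (nearestSq_nonneg _ ω) h2.le), Set.mem_preimage, Set.mem_Ico, div_le_iff₀ h2,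
      lt_div_iff₀ h2]
  rw [hs, setLIntegral_nearestSq_Ico hX hind n k θ _ (by gcongr; linarith), lintegral_const,
    Measure.restrict_apply_univ, mul_comm]

/-- This replaces conditioning on the nearest distance: the random loss may be exchanged for its
exponent evaluated at the random `s`. It holds for dyadic roundings, which are constant on each
cell, and both sides pass to the limit. -/
theorem lintegral_expNeg_totalLoss_nearestSq (hX : ∀ j, IsPoissonPointProcess P (lam j) (X j))
    (hind : iIndepFun (fun j ω => pointMeasure (X j) ω) P) (n : ι) (k : ℕ) {θ : ℝ} (hθ : 0 < θ) :
    ∫⁻ ω, expNeg (totalLoss X n k θ (nearestSq (X n) ω) (Set.Ioi (nearestSq (X n) ω)) ω) ∂P =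
    ∫⁻ ω, expNeg (lossExponent lam n k θ (nearestSq (X n) ω)
      (Set.Ioi (nearestSq (X n) ω))) ∂P := by
  have := hind.isProbabilityMeasure
  have hD := measurable_nearestSq (hX n).measurable_point
  have hN : ∀ p : ℕ, Measurable fun ω => ⌊nearestSq (X n) ω * 2 ^ p⌋₊ := fun p =>
    Nat.measurable_floor.comp (hD.mul_const _)
  have hL : Filter.Tendsto (fun p : ℕ => ∫⁻ ω, expNeg (totalLoss X n k θ
      ((⌊nearestSq (X n) ω * 2 ^ p⌋₊ : ℝ) / 2 ^ p)
      (Set.Ici (((⌊nearestSq (X n) ω * 2 ^ p⌋₊ : ℝ) + 1) / 2 ^ p)) ω) ∂P) Filter.atTop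
      (nhds (∫⁻ ω, expNeg (totalLoss X n k θ (nearestSq (X n) ω)
        (Set.Ioi (nearestSq (X n) ω)) ω) ∂P)) := by
    refine tendsto_lintegral_expNeg (fun p => ?_) (.of_forall fun ω => ?_)
    · exact measurable_comp_nat (hN p) (F := fun m ω => totalLoss X n k θ ((m : ℝ) / 2 ^ p)
        (Set.Ici (((m : ℝ) + 1) / 2 ^ p)) ω)
        (fun m => measurable_totalLoss hX n k θ _ measurableSet_Ici)
    · refine tendsto_finsetSum _ fun j _ => ?_
      exact lintegral_tendsto_of_tendsto_of_monotone
        (fun p => (measurable_lossAt n k θ _ measurableSet_Ici j).aemeasurable)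
        (.of_forall fun y => monotone_lossAt_dyadic n k hθ (nearestSq_nonneg _ ω) j y)
        (.of_forall fun y => tendsto_lossAt_dyadic n k hθ (nearestSq_nonneg _ ω) j y)
  have hR : Filter.Tendsto (fun p : ℕ => ∫⁻ ω, expNeg (lossExponent lam n k θ
      ((⌊nearestSq (X n) ω * 2 ^ p⌋₊ : ℝ) / 2 ^ p)
      (Set.Ici (((⌊nearestSq (X n) ω * 2 ^ p⌋₊ : ℝ) + 1) / 2 ^ p))) ∂P) Filter.atTop
      (nhds (∫⁻ ω, expNeg (lossExponent lam n k θ (nearestSq (X n) ω)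
        (Set.Ioi (nearestSq (X n) ω))) ∂P)) := by
    refine tendsto_lintegral_expNeg (fun p => ?_) (.of_forall fun ω => ?_)
    · exact measurable_comp_nat (hN p) (F := fun m _ => lossExponent lam n k θ ((m : ℝ) / 2 ^ p)
        (Set.Ici (((m : ℝ) + 1) / 2 ^ p))) (fun m => measurable_const)
    · refine tendsto_finsetSum _ fun j _ =>
        ENNReal.Tendsto.const_mul ?_ (Or.inr ENNReal.ofReal_ne_top)
      refine lintegral_tendsto_of_tendsto_of_monotone
        (fun p => (measurable_const.sub (measurable_expNeg.comp
          (measurable_lossAt n k θ _ measurableSet_Ici j))).aemeasurable)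
        (.of_forall fun y p q hpq => tsub_le_tsub_left (expNeg_antitone
          (monotone_lossAt_dyadic n k hθ (nearestSq_nonneg _ ω) j y hpq)) 1)
        (.of_forall fun y => ?_)
      exact ENNReal.Tendsto.sub tendsto_const_nhds ((continuous_expNeg.tendsto _).comp
        (tendsto_lossAt_dyadic n k hθ (nearestSq_nonneg _ ω) j y)) (Or.inl ENNReal.one_ne_top)
  simp_rw [lintegral_expNeg_totalLoss_dyadic hX hind] at hL
  exact tendsto_nhds_unique hL hR

theorem lossExponent_Ioi (hlam : ∀ j, 0 < lam j) (n : ι) (k : ℕ) {θ : ℝ} (hθ : 0 < θ) {s : ℝ}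
    (hs : 0 ≤ s) :
    lossExponent lam n k θ s (Set.Ioi s) = ENNReal.ofReal
      (lam n * Real.pi * (coverageDenominator lam n θ (zZero θ 4) k - 1) * s) := by
  have h0 : ∀ a : ℝ, 0 ≤ ∫ w in Set.Ioi a, (1 - (1 - θ / (w ^ 2 + θ)) ^ k) := fun a =>
    integral_nonneg fun w => one_sub_pow_nonneg hθ k w
  have h1 : ∀ j, ENNReal.ofReal (lam j) *
      ∫⁻ y : Plane, (1 - expNeg (lossAt n k θ s (Set.Ioi s) j y)) =
      ENNReal.ofReal (lam j * (Real.pi * (s * ∫ w in Set.Ioi (if j = n then (1 : ℝ) else 0),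
        (1 - (1 - θ / (w ^ 2 + θ)) ^ k)))) := by
    intro j
    have e : (if j = n then Set.Ioi s else Set.Ioi 0) =
        Set.Ioi (s * (if j = n then (1 : ℝ) else 0)) := by
      split_ifs <;> simp
    unfold lossAt
    rw [e, lintegral_plane_one_sub_expNeg hθ k hs (by split_ifs <;> norm_num),
      ← ENNReal.ofReal_mul (hlam j).le]
  rw [lossExponent]
  simp_rw [h1]
  rw [← ENNReal.ofReal_sum_of_nonneg fun j _ =>
    mul_nonneg (hlam j).le (mul_nonneg Real.pi_pos.le (mul_nonneg hs (h0 _)))]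
  congr 1
  rw [coverageDenominator_zZero n hθ, ← Finset.add_sum_erase _ _ (Finset.mem_univ n), if_pos rfl]
  have h2 : ∀ j ∈ Finset.univ.erase n, lam j * (Real.pi * (s * ∫ w in
      Set.Ioi (if j = n then (1 : ℝ) else 0), (1 - (1 - θ / (w ^ 2 + θ)) ^ k))) =
      lam n * Real.pi * s * (lam j / lam n *
        ∫ w in Set.Ioi (0 : ℝ), (1 - (1 - θ / (w ^ 2 + θ)) ^ k)) := by
    intro j hj
    rw [if_neg (Finset.ne_of_mem_erase hj)]
    have := (hlam n).ne'
    field_simp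
  rw [Finset.sum_congr rfl h2, ← Finset.mul_sum]
  ring

/-- With rate `r = λ_n π`, the Laplace transform `r / (r + c)` at `c = r (D_k - 1)` is `1 / D_k`. -/
theorem lintegral_expNeg_totalLoss (hlam : ∀ j, 0 < lam j)
    (hX : ∀ j, IsPoissonPointProcess P (lam j) (X j))
    (hind : iIndepFun (fun j ω => pointMeasure (X j) ω) P) (n : ι) (k : ℕ) {θ : ℝ} (hθ : 0 < θ) :
    ∫⁻ ω, expNeg (totalLoss X n 1 θ (nearestSq (X n) ω) (Set.Ioi (nearestSq (X n) ω)) ω) ^ k ∂P =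
      ENNReal.ofReal (1 / coverageDenominator lam n θ (zZero θ 4) k) := by
  have := hind.isProbabilityMeasure
  simp_rw [← expNeg_natCast_mul, ← totalLoss_eq_mul X n k θ _ measurableSet_Ioi]
  have hD := measurable_nearestSq (hX n).measurable_point
  have hr : 0 < lam n * Real.pi := mul_pos (hlam n) Real.pi_pos
  have hd : 1 ≤ coverageDenominator lam n θ (zZero θ 4) k :=
    one_le_coverageDenominator hlam n hθ (sum_choose_mul_zZero_nonneg hθ k)
  have hc : 0 ≤ lam n * Real.pi * (coverageDenominator lam n θ (zZero θ 4) k - 1) :=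
    mul_nonneg hr.le (by linarith)
  rw [lintegral_expNeg_totalLoss_nearestSq hX hind n k hθ]
  simp_rw [lossExponent_Ioi hlam n k hθ (nearestSq_nonneg (X n) _)]
  rw [← lintegral_map (f := fun x => expNeg (ENNReal.ofReal (lam n * Real.pi *
      (coverageDenominator lam n θ (zZero θ 4) k - 1) * x)))
      (measurable_expNeg.comp (by fun_prop)) hD, (hX n).map_nearestSq (hlam n),
    lintegral_expNeg_expMeasure hr hc]
  congr 1
  have : coverageDenominator lam n θ (zZero θ 4) k ≠ 0 := by linarith
  rw [show lam n * Real.pi + lam n * Real.pi * (coverageDenominator lam n θ (zZero θ 4) k - 1) =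
    lam n * Real.pi * coverageDenominator lam n θ (zZero θ 4) k by ring, div_mul_cancel_left₀ hr.ne',
    one_div]

end Moments

/-! ### Independent exponential fading -/

section Independence

variable {Ω : Type*} [MeasurableSpace Ω] {P : Measure Ω}

/-- Fubini for the product law; it allows the point configuration to be frozen while the fading
stays random. -/
theorem measure_mem_eq_lintegral_of_indepFun [IsFiniteMeasure P] {α β : Type*} [MeasurableSpace α]
    [MeasurableSpace β] {Y : Ω → α} {Z : Ω → β} (hY : Measurable Y) (hZ : Measurable Z)
    (hind : IndepFun Y Z P) {C : Set (α × β)} (hC : MeasurableSet C) :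
    P {ω | (Y ω, Z ω) ∈ C} = ∫⁻ ω, P {ω' | (Y ω, Z ω') ∈ C} ∂P := by
  have h := (indepFun_iff_map_prod_eq_prod_map_map hY.aemeasurable hZ.aemeasurable).1 hind
  have h1 : P {ω | (Y ω, Z ω) ∈ C} = P.map (fun ω => (Y ω, Z ω)) C :=
    (Measure.map_apply (hY.prodMk hZ) hC).symm
  rw [h1, h, Measure.prod_apply hC, lintegral_map (measurable_measure_prodMk_left hC) hY]
  refine lintegral_congr fun ω => ?_
  rw [Measure.map_apply hZ (measurable_prodMk_left hC)]
  rfl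

/-- Grouping by rows sends an infinite product law to a product of the row laws. It makes the bands,
each with its whole family of fadings, independent. -/
theorem iIndepFun_curry {κ τ β : Type*} [MeasurableSpace β] {H : κ → τ → Ω → β}
    (hm : ∀ k q, Measurable (H k q)) (hind : iIndepFun (fun (p : κ × τ) ω => H p.1 p.2 ω) P) :
    iIndepFun (fun k ω q => H k q ω) P := by
  have := hind.isProbabilityMeasure
  have hp : ∀ k q, IsProbabilityMeasure (P.map (H k q)) := fun k q =>
    Measure.isProbabilityMeasure_map (hm k q).aemeasurable
  have hrow : ∀ k, P.map (fun ω q => H k q ω) = Measure.infinitePi fun q => P.map (H k q) := by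
    intro k
    have hk : iIndepFun (fun q ω => H k q ω) P :=
      hind.precomp (g := fun q => (k, q)) fun a b hab => by simpa using hab
    exact hk.map_fun_eq_infinitePi_map (hm k)
  have hall := hind.map_fun_eq_infinitePi_map fun p : κ × τ => hm p.1 p.2
  rw [iIndepFun_iff_map_fun_eq_infinitePi_map fun k => measurable_pi_lambda _ (hm k)]
  simp_rw [hrow]
  rw [← Measure.infinitePi_map_curry, ← hall,
    Measure.map_map (by fun_prop) (measurable_pi_lambda _ fun p : κ × τ => hm p.1 p.2)]
  rfl

theorem indepFun_apply_compl {κ β : Type*} [MeasurableSpace β] {H : κ → Ω → β}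
    (hm : ∀ q, Measurable (H q)) (hind : iIndepFun H P) (x : κ) :
    IndepFun (fun ω (y : {y // y ≠ x}) => H y ω) (H x) P := by
  have h := indep_iSup_of_disjoint (fun q => (hm q).comap_le) hind
    (show Disjoint {x}ᶜ {x} from disjoint_compl_left)
  refine indep_of_indep_of_le_left (indep_of_indep_of_le_right h ?_) ?_
  · exact le_iSup₂_of_le x rfl le_rfl
  · rw [MeasurableSpace.pi, MeasurableSpace.comap_iSup]
    refine iSup_le fun y => ?_
    rw [MeasurableSpace.comap_comp]
    exact le_iSup₂_of_le (y : κ) y.2 le_rfl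

theorem measure_lt_of_hasLaw_expMeasure {H : Ω → ℝ} (hH : HasLaw H (expMeasure 1) P) (c : ℝ≥0∞) :
    P {ω | c < ENNReal.ofReal (H ω)} = expNeg c := by
  rcases eq_or_ne c ∞ with rfl | hc
  · simp [expNeg_top]
  · lift c to NNReal using hc
    have := isProbabilityMeasure_expMeasure one_pos
    have e : {ω | (c : ℝ≥0∞) < ENNReal.ofReal (H ω)} = {ω | H ω ∈ Set.Ioi (c : ℝ)} := by
      ext ω
      rw [Set.mem_ofPred_eq, ← ENNReal.ofReal_coe_nnreal,
        ENNReal.ofReal_lt_ofReal_iff_of_nonneg c.coe_nonneg]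
      rfl
    rw [e, hH.measure_eq (p := fun x => x ∈ Set.Ioi (c : ℝ)) measurableSet_Ioi]
    have hIic : expMeasure 1 (Set.Iic (c : ℝ)) = ENNReal.ofReal (1 - Real.exp (-c)) := by
      rw [← ofReal_cdf, cdf_expMeasure_eq one_pos, if_pos c.coe_nonneg, one_mul]
    have : Real.exp (-(c : ℝ)) ≤ 1 := Real.exp_le_one_iff.2 (by simp)
    change expMeasure 1 (Set.Ioi (c : ℝ)) = _
    rw [← Set.compl_Iic, prob_compl_eq_one_sub measurableSet_Iic, hIic,
      ← ENNReal.ofReal_coe_nnreal, expNeg_ofReal c.coe_nonneg, ← ENNReal.ofReal_one,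
      ← ENNReal.ofReal_sub _ (by linarith)]
    congr 1
    ring

theorem lintegral_expNeg_mul_of_hasLaw_expMeasure {H : Ω → ℝ} (hH : HasLaw H (expMeasure 1) P)
    {c : ℝ} (hc : 0 ≤ c) :
    ∫⁻ ω, expNeg (ENNReal.ofReal c * ENNReal.ofReal (H ω)) ∂P =
      expNeg (ENNReal.ofReal (Real.log (1 + c))) := by
  simp_rw [← ENNReal.ofReal_mul hc]
  rw [hH.lintegral_comp (f := fun x => expNeg (ENNReal.ofReal (c * x)))
    (measurable_expNeg.comp (by fun_prop)).aemeasurable, lintegral_expNeg_expMeasure one_pos hc,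
    expNeg_ofReal (Real.log_nonneg (by linarith)), Real.exp_neg, Real.exp_log (by linarith), one_div]

/-- Finite sums factor by independence. Countability of `κ` makes the filter of finite subsets
countably generated, so dominated convergence reaches the full sum, even if it is infinite. -/
theorem lintegral_expNeg_tsum_of_hasLaw_expMeasure {κ : Type*} [Countable κ] {H : κ → Ω → ℝ}
    (hm : ∀ q, Measurable (H q)) (hind : iIndepFun H P) (hH : ∀ q, HasLaw (H q) (expMeasure 1) P)
    {c : κ → ℝ} (hc : ∀ q, 0 ≤ c q) :
    ∫⁻ ω, expNeg (∑' q, ENNReal.ofReal (c q) * ENNReal.ofReal (H q ω)) ∂P =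
      expNeg (∑' q, ENNReal.ofReal (Real.log (1 + c q))) := by
  have := hind.isProbabilityMeasure
  have hm' : ∀ q, Measurable fun x : ℝ => ENNReal.ofReal (c q) * ENNReal.ofReal x := fun q =>
    by fun_prop
  have h1 := tendsto_lintegral_expNeg (P := P) (l := Filter.atTop)
    (F := fun (s : Finset κ) ω => ∑ q ∈ s, ENNReal.ofReal (c q) * ENNReal.ofReal (H q ω))
    (f := fun ω => ∑' q, ENNReal.ofReal (c q) * ENNReal.ofReal (H q ω))
    (fun s => Finset.measurable_fun_sum _ fun q _ => (hm' q).comp (hm q))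
    (.of_forall fun ω => ENNReal.summable.hasSum)
  have h2 : Filter.Tendsto (fun s : Finset κ => expNeg (∑ q ∈ s, ENNReal.ofReal (Real.log (1 + c q))))
      Filter.atTop (nhds (expNeg (∑' q, ENNReal.ofReal (Real.log (1 + c q))))) :=
    (continuous_expNeg.tendsto _).comp ENNReal.summable.hasSum
  refine tendsto_nhds_unique h1 (h2.congr fun s => ?_)
  simp_rw [expNeg_sum]
  rw [lintegral_prod_eq_prod_lintegral_of_indepFun s
    (fun q ω => expNeg (ENNReal.ofReal (c q) * ENNReal.ofReal (H q ω)))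
    (hind.comp _ fun q => measurable_expNeg.comp (hm' q))
    (fun q => (measurable_expNeg.comp (hm' q)).comp (hm q))]
  exact Finset.prod_congr rfl fun q _ =>
    (lintegral_expNeg_mul_of_hasLaw_expMeasure (hH q) (hc q)).symm

/-- An exponential random variable exceeds an independent weighted sum of exponential random
variables with the probability given by the product of the Laplace transforms. -/
theorem measure_tsum_lt_of_hasLaw_expMeasure {κ : Type*} [Countable κ] {H : κ → Ω → ℝ}
    (hm : ∀ q, Measurable (H q)) (hind : iIndepFun H P) (hH : ∀ q, HasLaw (H q) (expMeasure 1) P)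
    (x : κ) {c : κ → ℝ} (hc : ∀ q, 0 ≤ c q) :
    P {ω | ∑' y : {y // y ≠ x}, ENNReal.ofReal (c y) * ENNReal.ofReal (H y ω) <
        ENNReal.ofReal (H x ω)} =
      expNeg (∑' y : {y // y ≠ x}, ENNReal.ofReal (Real.log (1 + c y))) := by
  have := hind.isProbabilityMeasure
  have hC : MeasurableSet {z : ({y // y ≠ x} → ℝ) × ℝ |
      ∑' y : {y // y ≠ x}, ENNReal.ofReal (c y) * ENNReal.ofReal (z.1 y) < ENNReal.ofReal z.2} :=
    measurableSet_lt (Measurable.tsum fun y => by fun_prop) (by fun_prop)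
  refine (measure_mem_eq_lintegral_of_indepFun
    (measurable_pi_lambda _ fun y : {y // y ≠ x} => hm y) (hm x)
    (indepFun_apply_compl hm hind x) hC).trans ?_
  refine (lintegral_congr fun ω => measure_lt_of_hasLaw_expMeasure (hH x)
    (∑' y : {y // y ≠ x}, ENNReal.ofReal (c y) * ENNReal.ofReal (H y ω))).trans ?_
  exact lintegral_expNeg_tsum_of_hasLaw_expMeasure (fun y : {y // y ≠ x} => hm y)
    (hind.precomp Subtype.val_injective) (fun y => hH y) (fun y => hc y)

theorem measure_exists_eq_one_sub_pow [IsProbabilityMeasure P] {κ β : Type*} [Fintype κ]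
    [MeasurableSpace β] {W : κ → Ω → β} (hW : ∀ k, Measurable (W k)) (hind : iIndepFun W P)
    {S : κ → Set β} (hS : ∀ k, MeasurableSet (S k)) {q : ℝ≥0∞} (hq : ∀ k, P (W k ⁻¹' S k) = q) :
    P {ω | ∃ k, W k ω ∈ S k} = 1 - (1 - q) ^ Fintype.card κ := by
  have h := hind.measure_inter_preimage_eq_mul Finset.univ (sets := fun k => (S k)ᶜ)
    fun k _ => (hS k).compl
  have h1 : ∀ k, P (W k ⁻¹' (S k)ᶜ) = 1 - q := fun k => by
    rw [Set.preimage_compl, prob_compl_eq_one_sub (hW k (hS k)), hq k]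
  simp_rw [h1] at h
  rw [Finset.prod_const, Finset.card_univ] at h
  have e : {ω | ∃ k, W k ω ∈ S k} = (⋂ k ∈ Finset.univ, W k ⁻¹' (S k)ᶜ)ᶜ := by
    ext ω
    simp
  rw [e, prob_compl_eq_one_sub, h]
  exact MeasurableSet.iInter fun k => MeasurableSet.iInter fun _ => hW k (hS k).compl

end Independence

/-! ### Almost sure properties: no point at the origin, no ties, a unique nearest point -/

section AlmostSure

variable {Ω : Type*} [MeasurableSpace Ω] {P : Measure Ω} {lam : ℝ} {X : ℕ → Ω → Plane}

theorem pointMeasure_apply {Ω : Type*} (X : ℕ → Ω → Plane) (ω : Ω) {B : Set Plane}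
    (hB : MeasurableSet B) : pointMeasure X ω B = ∑' i, B.indicator 1 (X i ω) := by
  rw [pointMeasure, Measure.sum_apply _ hB]
  exact tsum_congr fun i => Measure.dirac_apply' _ hB

theorem IsPoissonPointProcess.measure_count_mem (hX : IsPoissonPointProcess P lam X) {B : Set Plane}
    (hB : MeasurableSet B) (hB' : volume B ≠ ∞) {S : Set ℝ≥0∞} (hS : MeasurableSet S) :
    P {ω | pointMeasure X ω B ∈ S} =
      poissonMeasure (ENNReal.ofReal lam * volume B).toNNReal ((fun m : ℕ => (m : ℝ≥0∞)) ⁻¹' S) := by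
  rw [← Measure.map_apply (measurable_of_countable _) hS]
  exact (hX.count_law B hB hB').measure_eq (p := fun c => c ∈ S) hS

theorem IsPoissonPointProcess.ae_ne_zero (hX : IsPoissonPointProcess P lam X) :
    ∀ᵐ ω ∂P, ∀ i, X i ω ≠ 0 := by
  have h0 : MeasurableSet ({0} : Set Plane) := measurableSet_singleton 0
  have h2 : ∀ᵐ ω ∂P, pointMeasure X ω {0} = 0 := by
    have h := hX.measure_count_mem h0 (by simp) (measurableSet_singleton (0 : ℝ≥0∞)).compl
    have e : (fun m : ℕ => (m : ℝ≥0∞)) ⁻¹' {0}ᶜ = {0}ᶜ := by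
      ext m
      simp
    rw [e, prob_compl_eq_one_sub (measurableSet_singleton 0), poissonMeasure_singleton] at h
    rw [ae_iff]
    refine h.trans ?_
    simp
  filter_upwards [h2] with ω hω i hi
  rw [pointMeasure_apply X ω h0, ENNReal.tsum_eq_zero] at hω
  simpa [hi] using hω i

theorem IsPoissonPointProcess.ae_finite_ball (hX : IsPoissonPointProcess P lam X) (R : ℝ) :
    ∀ᵐ ω ∂P, {i | ‖X i ω‖ < R}.Finite := by
  have hB : MeasurableSet (Metric.ball (0 : Plane) R) := measurableSet_ball
  have h2 : ∀ᵐ ω ∂P, pointMeasure X ω (Metric.ball 0 R) ≠ ∞ := by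
    have h := hX.measure_count_mem hB measure_ball_lt_top.ne (measurableSet_singleton (∞ : ℝ≥0∞))
    have e : (fun m : ℕ => (m : ℝ≥0∞)) ⁻¹' {∞} = ∅ := by
      ext m
      simp
    rw [e, measure_empty] at h
    rw [ae_iff]
    simpa only [not_not, Set.mem_singleton_iff] using h
  filter_upwards [h2] with ω hω
  rw [pointMeasure_apply X ω hB] at hω
  refine (ENNReal.finite_const_le_of_tsum_ne_top hω one_ne_zero).subset fun i hi => ?_
  have : X i ω ∈ Metric.ball (0 : Plane) R := by simpa using hi
  simp [this]

theorem IsPoissonPointProcess.measure_two_le_count (hX : IsPoissonPointProcess P lam X)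
    {B : Set Plane} (hB : MeasurableSet B) (hB' : volume B ≠ ∞) :
    P {ω | 2 ≤ pointMeasure X ω B} ≤
      ENNReal.ofReal ((ENNReal.ofReal lam * volume B).toReal ^ 2) := by
  set r := (ENNReal.ofReal lam * volume B).toNNReal with hr
  have h := hX.measure_count_mem hB hB' (measurableSet_Ici (a := 2))
  have e : (fun m : ℕ => (m : ℝ≥0∞)) ⁻¹' Set.Ici 2 = ({0} ∪ {1} : Set ℕ)ᶜ := by
    ext m
    have : (2 : ℝ≥0∞) ≤ m ↔ 2 ≤ m := by exact_mod_cast Iff.rfl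
    simp [this]
    omega
  have hp : IsProbabilityMeasure (poissonMeasure r) := inferInstance
  refine h.trans_le ?_
  rw [← hr, e, prob_compl_eq_one_sub (by measurability), measure_union (by simp) (by measurability),
    poissonMeasure_singleton, poissonMeasure_singleton, ← ENNReal.ofReal_add (by positivity)
    (by positivity), ← ENNReal.ofReal_one, ← ENNReal.ofReal_sub _ (by positivity)]
  refine ENNReal.ofReal_le_ofReal ?_
  -- From `exp (-r) ≥ 1 - r` one gets `1 - (1 + r) exp (-r) ≤ r²`.
  have h1 := Real.add_one_le_exp (-(r : ℝ))
  have h2 : (0 : ℝ) ≤ r := r.coe_nonneg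
  change _ ≤ (r : ℝ) ^ 2
  simp
  nlinarith

theorem volume_norm_sq_mem_Ico {a b : ℝ} (ha : 0 ≤ a) :
    volume {y : Plane | ‖y‖ ^ 2 ∈ Set.Ico a b} = ENNReal.ofReal (Real.pi * (b - a)) := by
  have h := congrArg (fun μ => μ (Set.Ico a b)) map_norm_sq_volume_plane
  simp only [Measure.smul_apply, smul_eq_mul] at h
  rw [Measure.map_apply (by fun_prop) measurableSet_Ico, restrict_Ioi_eq_restrict_Ici,
    Measure.restrict_apply measurableSet_Ico, Set.inter_eq_left.2 (Set.Ico_subset_Ici_self.trans (Set.Ici_subset_Ici.2 ha)),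
    Real.volume_Ico, ← ENNReal.ofReal_mul Real.pi_pos.le] at h
  exact h

/-- Two points at equal distance share a dyadic annulus at every scale. Below squared radius `R`
there are `R 2^p` annuli of area `π / 2^p`, each holding two points with probability at most `(λ π /
2^p)²`; the union bound is of order `2^(-p)`. -/
theorem IsPoissonPointProcess.ae_injective_norm [IsFiniteMeasure P] (hlam : 0 < lam)
    (hX : IsPoissonPointProcess P lam X) : ∀ᵐ ω ∂P, Function.Injective fun i => ‖X i ω‖ := by
  have key : ∀ R : ℕ, P {ω | ∃ i i', i ≠ i' ∧ ‖X i ω‖ = ‖X i' ω‖ ∧ ‖X i ω‖ ^ 2 < R} = 0 := by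
    intro R
    have hA : ∀ a b : ℝ, MeasurableSet {y : Plane | ‖y‖ ^ 2 ∈ Set.Ico a b} := fun a b =>
      (by fun_prop : Measurable fun y : Plane => ‖y‖ ^ 2) measurableSet_Ico
    have hp : ∀ p : ℕ, P {ω | ∃ i i', i ≠ i' ∧ ‖X i ω‖ = ‖X i' ω‖ ∧ ‖X i ω‖ ^ 2 < R} ≤
        ENNReal.ofReal (R * (lam * Real.pi) ^ 2 * (1 / 2) ^ p) := by
      intro p
      have h2 : (0 : ℝ) < 2 ^ p := by positivity
      let A : ℕ → Set Plane := fun m =>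
        {y : Plane | ‖y‖ ^ 2 ∈ Set.Ico ((m : ℝ) / 2 ^ p) (((m : ℝ) + 1) / 2 ^ p)}
      have hv : ∀ m, volume (A m) = ENNReal.ofReal (Real.pi / 2 ^ p) := fun m => by
        rw [volume_norm_sq_mem_Ico (by positivity)]
        congr 1
        field_simp
        ring
      have hsub : {ω | ∃ i i', i ≠ i' ∧ ‖X i ω‖ = ‖X i' ω‖ ∧ ‖X i ω‖ ^ 2 < R} ⊆
          ⋃ m ∈ Finset.range (R * 2 ^ p), {ω | 2 ≤ pointMeasure X ω (A m)} := by
        rintro ω ⟨i, i', hii, heq, hlt⟩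
        have hnn : 0 ≤ ‖X i ω‖ ^ 2 * 2 ^ p := by positivity
        have hi : X i ω ∈ A ⌊‖X i ω‖ ^ 2 * 2 ^ p⌋₊ :=
          ⟨(div_le_iff₀ h2).2 (Nat.floor_le hnn), (lt_div_iff₀ h2).2 (Nat.lt_floor_add_one _)⟩
        have hi' : X i' ω ∈ A ⌊‖X i ω‖ ^ 2 * 2 ^ p⌋₊ := by
          have := hi
          simp only [A, Set.mem_ofPred_eq] at this ⊢
          rwa [heq] at this ⊢
        refine Set.mem_biUnion (x := ⌊‖X i ω‖ ^ 2 * 2 ^ p⌋₊) ?_ ?_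
        · rw [Finset.coe_range, Set.mem_Iio, Nat.floor_lt hnn]
          push_cast
          exact mul_lt_mul_of_pos_right hlt h2
        · rw [Set.mem_ofPred_eq, pointMeasure_apply X ω (hA _ _)]
          refine le_trans (le_of_eq ?_) (ENNReal.sum_le_tsum {i, i'})
          rw [Finset.sum_pair hii, Set.indicator_of_mem hi, Set.indicator_of_mem hi']
          norm_num
      refine (measure_mono hsub).trans ((measure_biUnion_finset_le _ _).trans ?_)
      refine (Finset.sum_le_sum fun m _ =>
        hX.measure_two_le_count (hA _ _) (by rw [hv]; exact ENNReal.ofReal_ne_top)).trans ?_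
      simp_rw [A] at hv
      simp_rw [hv, ← ENNReal.ofReal_mul hlam.le]
      rw [ENNReal.toReal_ofReal (by positivity), Finset.sum_const, Finset.card_range, nsmul_eq_mul,
        ← ENNReal.ofReal_natCast, ← ENNReal.ofReal_mul (by positivity)]
      refine ENNReal.ofReal_le_ofReal (le_of_eq ?_)
      push_cast
      rw [one_div, inv_pow]
      field_simp
    have hlim : Filter.Tendsto
        (fun p : ℕ => ENNReal.ofReal (R * (lam * Real.pi) ^ 2 * (1 / 2) ^ p)) Filter.atTop
        (nhds 0) := by
      have := (tendsto_pow_atTop_nhds_zero_of_lt_one (by norm_num : (0 : ℝ) ≤ 1 / 2)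
        (by norm_num)).const_mul (R * (lam * Real.pi) ^ 2)
      simpa using ENNReal.tendsto_ofReal this
    exact le_antisymm (ge_of_tendsto' hlim hp) bot_le
  have h : ∀ᵐ ω ∂P, ∀ R : ℕ, ¬ ∃ i i', i ≠ i' ∧ ‖X i ω‖ = ‖X i' ω‖ ∧ ‖X i ω‖ ^ 2 < R := by
    rw [ae_all_iff]
    intro R
    rw [ae_iff]
    simpa only [not_not] using key R
  filter_upwards [h] with ω hω i i' hii
  by_contra hne
  obtain ⟨R, hR⟩ := exists_nat_gt (‖X i ω‖ ^ 2)
  exact hω R ⟨i, i', hne, hii, hR⟩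

theorem IsPoissonPointProcess.ae_exists_nearest [IsFiniteMeasure P] (hlam : 0 < lam)
    (hX : IsPoissonPointProcess P lam X) :
    ∀ᵐ ω ∂P, ∃ i₀, ∀ i, i ≠ i₀ → ‖X i₀ ω‖ < ‖X i ω‖ := by
  have hfin : ∀ᵐ ω ∂P, ∀ R : ℕ, {i | ‖X i ω‖ < R}.Finite :=
    ae_all_iff.2 fun R => hX.ae_finite_ball R
  filter_upwards [hfin, hX.ae_injective_norm hlam] with ω h1 h2
  obtain ⟨R, hR⟩ := exists_nat_gt ‖X 0 ω‖
  obtain ⟨i₀, hi₀, hmin⟩ := Set.exists_min_image _ (fun i => ‖X i ω‖) (h1 R) ⟨0, hR⟩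
  refine ⟨i₀, fun i hi => lt_of_le_of_ne ?_ fun he => hi (h2 he).symm⟩
  rcases lt_or_ge ‖X i ω‖ R with h | h
  · exact hmin i h
  · exact (le_of_lt hi₀).trans h

end AlmostSure

/-! ### The coverage event and its probability -/

section Coverage

variable {Ω : Type*} {ι : Type*}

theorem receivedPower_four {X : ι → ℕ → Ω → Plane} (h : ι → ℕ → ι → Ω → ℝ) (k : ι) {q : ι × ℕ}
    {ω : Ω} (hq : X q.1 q.2 ω ≠ 0) :
    receivedPower 4 X h k q ω =
      ENNReal.ofReal (h q.1 q.2 k ω) * ENNReal.ofReal ((‖X q.1 q.2 ω‖ ^ 4)⁻¹) := by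
  have h0 : 0 < ‖X q.1 q.2 ω‖ := norm_pos_iff.2 hq
  rw [receivedPower, ← ofReal_norm, ENNReal.ofReal_rpow_of_pos h0, Real.rpow_neg h0.le]
  norm_cast

theorem lt_sinr_iff {X : ι → ℕ → Ω → Plane} (h : ι → ℕ → ι → Ω → ℝ) {θ : ℝ} (hθ : 0 < θ) (η : ℝ)
    (k : ι) (x : ι × ℕ) {ω : Ω} (hX : ∀ j i, X j i ω ≠ 0) :
    ENNReal.ofReal θ < sinr 4 0 η X h k x ω ↔
      ∑' y : {y : ι × ℕ // y ≠ x},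
        ENNReal.ofReal (θ * (‖X x.1 x.2 ω‖ ^ 2 / ‖X y.1.1 y.1.2 ω‖ ^ 2) ^ 2) *
          ENNReal.ofReal (h y.1.1 y.1.2 k ω) < ENNReal.ofReal (h x.1 x.2 k ω) := by
  have h0 : 0 < ‖X x.1 x.2 ω‖ := norm_pos_iff.2 (hX _ _)
  have ha0 : ENNReal.ofReal (‖X x.1 x.2 ω‖ ^ 4)⁻¹ ≠ 0 := by
    rw [ne_eq, ENNReal.ofReal_eq_zero, not_le]
    positivity
  -- Because `θ` is positive and finite, the division can be cleared even if the interference is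
  -- zero or infinite.
  rw [sinr, ENNReal.lt_div_iff_mul_lt (Or.inr ENNReal.ofReal_ne_top)
    (Or.inr (by simpa using hθ)), mul_zero, ENNReal.ofReal_zero, zero_add,
    receivedPower_four h k (hX _ _), ← ENNReal.tsum_mul_left]
  have e : ∀ y : {y : ι × ℕ // y ≠ x}, ENNReal.ofReal θ * receivedPower 4 X h k y ω =
      ENNReal.ofReal (θ * (‖X x.1 x.2 ω‖ ^ 2 / ‖X y.1.1 y.1.2 ω‖ ^ 2) ^ 2) *
        ENNReal.ofReal (h y.1.1 y.1.2 k ω) * ENNReal.ofReal (‖X x.1 x.2 ω‖ ^ 4)⁻¹ := by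
    intro y
    have h1 : 0 < ‖X y.1.1 y.1.2 ω‖ := norm_pos_iff.2 (hX _ _)
    have h2 : ENNReal.ofReal θ * ENNReal.ofReal (‖X y.1.1 y.1.2 ω‖ ^ 4)⁻¹ =
        ENNReal.ofReal (θ * (‖X x.1 x.2 ω‖ ^ 2 / ‖X y.1.1 y.1.2 ω‖ ^ 2) ^ 2) *
          ENNReal.ofReal (‖X x.1 x.2 ω‖ ^ 4)⁻¹ := by
      rw [← ENNReal.ofReal_mul hθ.le, ← ENNReal.ofReal_mul (by positivity)]
      congr 1
      field_simp
    rw [receivedPower_four h k (hX _ _), mul_left_comm, h2]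
    ring
  simp_rw [e]
  rw [ENNReal.tsum_mul_right, ENNReal.mul_lt_mul_iff_left ha0 ENNReal.ofReal_ne_top]

theorem isCovered_iff [Fintype ι] {X : ι → ℕ → Ω → Plane} (h : ι → ℕ → ι → Ω → ℝ) {θ : ℝ}
    (hθ : 0 < θ) (n : ι) {ω : Ω} (hX : ∀ j i, X j i ω ≠ 0) {i₀ : ℕ}
    (hi₀ : ∀ i, i ≠ i₀ → ‖X n i₀ ω‖ < ‖X n i ω‖) :
    IsCovered 4 0 X h n θ ω ↔ ∃ k : ι,
      ∑' y : {y : ι × ℕ // y ≠ (n, i₀)},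
        ENNReal.ofReal (θ * (‖X n i₀ ω‖ ^ 2 / ‖X y.1.1 y.1.2 ω‖ ^ 2) ^ 2) *
          ENNReal.ofReal (h y.1.1 y.1.2 k ω) < ENNReal.ofReal (h n i₀ k ω) := by
  constructor
  · rintro ⟨i, hi, k, hk⟩
    obtain rfl : i = i₀ := by
      by_contra hne
      exact absurd (hi i₀) (not_le.2 (hi₀ i hne))
    exact ⟨k, (lt_sinr_iff h hθ _ k (n, i) hX).1 hk⟩
  · rintro ⟨k, hk⟩
    refine ⟨i₀, fun i => ?_, k, (lt_sinr_iff h hθ _ k (n, i₀) hX).2 hk⟩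
    rcases eq_or_ne i i₀ with rfl | hi
    exacts [le_rfl, (hi₀ i hi).le]

/-- With a strict minimiser, squared distance above the minimum singles out exactly the points of
operator `n` other than the serving one; for other operators positivity of the distance keeps every
point. -/
theorem totalLoss_nearestSq [Fintype ι] [DecidableEq ι] {X : ι → ℕ → Ω → Plane} (θ : ℝ)
    (n : ι) {ω : Ω} (hX : ∀ j i, X j i ω ≠ 0) {i₀ : ℕ}
    (hi₀ : ∀ i, i ≠ i₀ → ‖X n i₀ ω‖ < ‖X n i ω‖) :
    totalLoss X n 1 θ (nearestSq (X n) ω) (Set.Ioi (nearestSq (X n) ω)) ω =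
      ∑' y : {y : ι × ℕ // y ≠ (n, i₀)},
        ENNReal.ofReal (Real.log (1 + θ * (‖X n i₀ ω‖ ^ 2 / ‖X y.1.1 y.1.2 ω‖ ^ 2) ^ 2)) := by
  have hs : nearestSq (X n) ω = ‖X n i₀ ω‖ ^ 2 := by
    refine le_antisymm ((le_nearestSq_iff (X n) ω _).1 le_rfl i₀)
      ((le_nearestSq_iff (X n) ω _).2 fun i => ?_)
    rcases eq_or_ne i i₀ with rfl | hi
    · exact le_rfl
    · exact pow_le_pow_left₀ (norm_nonneg _) (hi₀ i hi).le 2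
  rw [totalLoss, hs]
  simp_rw [lintegral_pointMeasure (X _) ω (measurable_lossAt n 1 θ _ measurableSet_Ioi _)]
  refine Eq.trans ?_ (tsum_subtype {y : ι × ℕ | y ≠ (n, i₀)} fun y : ι × ℕ =>
    ENNReal.ofReal (Real.log (1 + θ * (‖X n i₀ ω‖ ^ 2 / ‖X y.1 y.2 ω‖ ^ 2) ^ 2))).symm
  rw [ENNReal.tsum_prod', tsum_fintype]
  refine Finset.sum_congr rfl fun j _ => tsum_congr fun i => ?_
  have hiff : ‖X j i ω‖ ^ 2 ∈ (if j = n then Set.Ioi (‖X n i₀ ω‖ ^ 2) else Set.Ioi 0) ↔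
      (j, i) ∈ {y : ι × ℕ | y ≠ (n, i₀)} := by
    rw [Set.mem_ofPred_eq, ne_eq, Prod.mk_inj, not_and]
    split_ifs with hj
    · subst hj
      constructor
      · rintro h - rfl
        exact lt_irrefl _ (Set.mem_Ioi.1 h)
      · intro h
        exact pow_lt_pow_left₀ (hi₀ i (h rfl)) (norm_nonneg _) two_ne_zero
    · exact ⟨fun _ h => absurd h hj,
        fun _ => Set.mem_Ioi.2 (pow_pos (norm_pos_iff.2 (hX j i)) 2)⟩
  unfold lossAt
  by_cases hm : (j, i) ∈ {y : ι × ℕ | y ≠ (n, i₀)}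
  · rw [Set.indicator_of_mem hm, Set.indicator_of_mem (hiff.2 hm), Nat.cast_one, one_mul, pointLoss]
  · rw [Set.indicator_of_notMem hm, Set.indicator_of_notMem fun h => hm (hiff.1 h)]

theorem measurableSet_isCovered [MeasurableSpace Ω] [Fintype ι] {X : ι → ℕ → Ω → Plane}
    {h : ι → ℕ → ι → Ω → ℝ} (hX : ∀ j i, Measurable (X j i)) (hh : ∀ j i k, Measurable (h j i k))
    (α W : ℝ) (n : ι) (θ : ℝ) : MeasurableSet {ω | IsCovered α W X h n θ ω} := by
  have hr : ∀ k q, Measurable (receivedPower α X h k q) := fun k q =>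
    (hh _ _ _).ennreal_ofReal.mul ((hX _ _).enorm.pow_const _)
  have hs : ∀ k x, Measurable (sinr α W (Fintype.card ι) X h k x) := fun k x =>
    (hr k x).div (measurable_const.add
      (Measurable.tsum (f := fun (y : {y // y ≠ x}) ω => receivedPower α X h k y ω)
        fun y => hr k y))
  have e : {ω | IsCovered α W X h n θ ω} = ⋃ i : ℕ,
      (⋂ i', {ω | ‖X n i ω‖ ≤ ‖X n i' ω‖}) ∩
        ⋃ k : ι, {ω | ENNReal.ofReal θ < sinr α W (Fintype.card ι) X h k (n, i) ω} := by
    ext ω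
    simp [IsCovered]
  rw [e]
  refine MeasurableSet.iUnion fun i => (MeasurableSet.iInter fun i' =>
    measurableSet_le (hX _ _).norm (hX _ _).norm).inter (MeasurableSet.iUnion fun k =>
    measurableSet_lt measurable_const (hs k _))

theorem measurable_totalLoss_nearestSq [MeasurableSpace Ω] [Fintype ι] [DecidableEq ι]
    {X : ι → ℕ → Ω → Plane} (hX : ∀ j i, Measurable (X j i)) (θ : ℝ) (n : ι) :
    Measurable fun ω =>
      totalLoss X n 1 θ (nearestSq (X n) ω) (Set.Ioi (nearestSq (X n) ω)) ω := by
  have hD := measurable_nearestSq (hX n)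
  unfold totalLoss
  -- The integrand depends on `ω` through the nearest distance, so measurability is read off the sum
  -- over points.
  simp_rw [lintegral_pointMeasure (X _) _ (measurable_lossAt n 1 θ _ measurableSet_Ioi _)]
  refine Finset.measurable_fun_sum _ fun j _ => Measurable.tsum fun i => ?_
  have hV : Measurable fun ω => ‖X j i ω‖ ^ 2 := (hX j i).norm.pow_const 2
  have hL : Measurable fun ω => ((1 : ℕ) : ℝ≥0∞) *
      pointLoss θ (nearestSq (X n) ω) (‖X j i ω‖ ^ 2) := by
    unfold pointLoss
    fun_prop
  by_cases hj : j = n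
  · simpa only [lossAt, if_pos hj] using! hL.indicator (measurableSet_lt hD hV)
  · simpa only [lossAt, if_neg hj] using! hL.indicator (measurableSet_lt measurable_const hV)

variable [MeasurableSpace Ω] {P : Measure Ω} [Fintype ι] {lam : ι → ℝ}
  {X : ι → ℕ → Ω → Plane} {h : ι → ℕ → ι → Ω → ℝ}

theorem IsFreqSelectiveNetwork.measure_isCovered_const [IsProbabilityMeasure P]
    (hnet : IsFreqSelectiveNetwork P lam X h) {θ : ℝ} (hθ : 0 < θ) (n : ι) {x : ι → ℕ → Plane}
    (hx : ∀ j i, x j i ≠ 0) {i₀ : ℕ} (hi₀ : ∀ i, i ≠ i₀ → ‖x n i₀‖ < ‖x n i‖) :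
    P {ω | IsCovered 4 0 (fun j i _ => x j i) h n θ ω} =
      1 - (1 - expNeg (∑' y : {y : ι × ℕ // y ≠ (n, i₀)},
        ENNReal.ofReal (Real.log (1 + θ * (‖x n i₀‖ ^ 2 / ‖x y.1.1 y.1.2‖ ^ 2) ^ 2)))) ^
        Fintype.card ι := by
  let W : ι → Ω → (ι × ℕ → ℝ) := fun k ω q => h q.1 q.2 k ω
  have hWm : ∀ k, Measurable (W k) := fun k =>
    measurable_pi_lambda _ fun q => hnet.fading_measurable q.1 q.2 k
  have hWi : iIndepFun W P := by
    have hp : iIndepFun (fun (p : ι × (ι × ℕ)) ω => h p.2.1 p.2.2 p.1 ω) P := hnet.fading_indep.precomp (g := fun p : ι × (ι × ℕ) => (p.2.1, p.2.2, p.1))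
      fun a b hab => by
        simp only [Prod.mk.injEq] at hab
        exact Prod.ext hab.2.2 (Prod.ext hab.1 hab.2.1)
    exact iIndepFun_curry (H := fun k (q : ι × ℕ) => h q.1 q.2 k)
      (fun k q => hnet.fading_measurable q.1 q.2 k) hp
  have hband : ∀ k, iIndepFun (fun (q : ι × ℕ) ω => h q.1 q.2 k ω) P := fun k =>
    hnet.fading_indep.precomp (g := fun q : ι × ℕ => (q.1, q.2, k)) fun a b hab => by
      simp only [Prod.mk.injEq] at hab
      exact Prod.ext hab.1 hab.2.1
  let c : ι × ℕ → ℝ := fun y => θ * (‖x n i₀‖ ^ 2 / ‖x y.1 y.2‖ ^ 2) ^ 2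
  let S : Set (ι × ℕ → ℝ) := {w | ∑' y : {y : ι × ℕ // y ≠ (n, i₀)},
    ENNReal.ofReal (c y) * ENNReal.ofReal (w y) < ENNReal.ofReal (w (n, i₀))}
  have hS : MeasurableSet S :=
    measurableSet_lt (Measurable.tsum fun y => by fun_prop) (by fun_prop)
  have hq : ∀ k, P (W k ⁻¹' S) = expNeg (∑' y : {y : ι × ℕ // y ≠ (n, i₀)},
      ENNReal.ofReal (Real.log (1 + c y))) := fun k =>
    measure_tsum_lt_of_hasLaw_expMeasure (H := fun (q : ι × ℕ) => h q.1 q.2 k)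
      (fun q => hnet.fading_measurable q.1 q.2 k)
      (hband k)
      (fun q => hnet.fading_law q.1 q.2 k) (n, i₀) fun q => by positivity
  have hcov : {ω | IsCovered 4 0 (fun j i _ => x j i) h n θ ω} = {ω | ∃ k, W k ω ∈ S} := by
    ext ω
    simp only [Set.mem_ofPred_eq, S, W, c]
    exact isCovered_iff (X := fun j i _ => x j i) h hθ n hx hi₀
  rw [hcov]
  exact measure_exists_eq_one_sub_pow hWm hWi (fun _ => hS) hq

variable [DecidableEq ι]

theorem IsFreqSelectiveNetwork.measure_isCovered [IsProbabilityMeasure P]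
    (hlam : ∀ j, 0 < lam j) (hnet : IsFreqSelectiveNetwork P lam X h) {θ : ℝ} (hθ : 0 < θ) (n : ι) :
    P {ω | IsCovered 4 0 X h n θ ω} = ∫⁻ ω, (1 - (1 - expNeg (totalLoss X n 1 θ
      (nearestSq (X n) ω) (Set.Ioi (nearestSq (X n) ω)) ω)) ^ Fintype.card ι) ∂P := by
  have hXm : ∀ j i, Measurable (X j i) := fun j i => (hnet.poisson j).measurable_point i
  -- Coverage is viewed as a measurable set of pairs of a configuration and a fading array, with
  -- coordinate maps in place of `X` and `h`.
  have hC := measurableSet_isCovered (Ω := (ι → ℕ → Plane) × (ι → ℕ → ι → ℝ))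
    (X := fun j i z => z.1 j i) (h := fun j i k z => z.2 j i k) (fun j i => by fun_prop)
    (fun j i k => by fun_prop) 4 0 n θ
  refine (measure_mem_eq_lintegral_of_indepFun
    (measurable_pi_lambda _ fun j => measurable_pi_lambda _ fun i => hXm j i)
    (measurable_pi_lambda _ fun j => measurable_pi_lambda _ fun i =>
      measurable_pi_lambda _ fun k => hnet.fading_measurable j i k)
    hnet.fading_indep_points hC).trans (lintegral_congr_ae ?_)
  have h0 : ∀ᵐ ω ∂P, ∀ j i, X j i ω ≠ 0 := ae_all_iff.2 fun j => (hnet.poisson j).ae_ne_zero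
  filter_upwards [h0, (hnet.poisson n).ae_exists_nearest (hlam n)] with ω h1 ⟨i₀, h2⟩
  rw [totalLoss_nearestSq θ n h1 h2]
  exact hnet.measure_isCovered_const hθ n h1 h2

theorem IsFreqSelectiveNetwork.coverageProbability_eq [IsProbabilityMeasure P]
    (hlam : ∀ j, 0 < lam j) (hnet : IsFreqSelectiveNetwork P lam X h) {θ : ℝ} (hθ : 0 < θ) (n : ι) :
    coverageProbability P 4 0 X h n θ = coverageForm lam n θ (zZero θ 4) := by
  have hXm : ∀ j i, Measurable (X j i) := fun j i => (hnet.poisson j).measurable_point i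
  let Q : Ω → ℝ≥0∞ := fun ω => expNeg (totalLoss X n 1 θ
    (nearestSq (X n) ω) (Set.Ioi (nearestSq (X n) ω)) ω)
  have hQ : Measurable Q := measurable_expNeg.comp (measurable_totalLoss_nearestSq hXm θ n)
  have hQ1 : ∀ ω, Q ω ≤ 1 := fun ω => expNeg_le_one _
  have hq1 : ∀ ω, (Q ω).toReal ≤ 1 := fun ω => ENNReal.toReal_le_of_le_ofReal zero_le_one
    (by simpa using hQ1 ω)
  have hpow : ∀ k : ℕ, ∫ ω, (Q ω).toReal ^ k ∂P =
      1 / coverageDenominator lam n θ (zZero θ 4) k := by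
    intro k
    have hd : 1 ≤ coverageDenominator lam n θ (zZero θ 4) k :=
      one_le_coverageDenominator hlam n hθ (sum_choose_mul_zZero_nonneg hθ k)
    simp_rw [← ENNReal.toReal_pow]
    rw [integral_toReal (hQ.pow_const k).aemeasurable (.of_forall fun ω =>
      ENNReal.pow_lt_top ((hQ1 ω).trans_lt ENNReal.one_lt_top)),
      lintegral_expNeg_totalLoss hlam hnet.poisson hnet.operators_indep n k hθ,
      ENNReal.toReal_ofReal (by positivity)]
  have hint : ∀ k : ℕ, Integrable (fun ω => (Q ω).toReal ^ k) P := fun k =>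
    Integrable.of_bound (hQ.ennreal_toReal.pow_const k).aestronglyMeasurable 1
      (.of_forall fun ω => by
        rw [norm_pow, Real.norm_of_nonneg ENNReal.toReal_nonneg]
        exact pow_le_one₀ ENNReal.toReal_nonneg (hq1 ω))
  have hcov : coverageProbability P 4 0 X h n θ =
      ∫ ω, (1 - (1 - (Q ω).toReal) ^ Fintype.card ι) ∂P := by
    have hm : Measurable fun ω => 1 - (1 - Q ω) ^ Fintype.card ι :=
      measurable_const.sub ((measurable_const.sub hQ).pow_const _)
    rw [coverageProbability, measureReal_def, hnet.measure_isCovered hlam hθ n,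
      ← integral_toReal hm.aemeasurable
        (.of_forall fun ω => tsub_le_self.trans_lt ENNReal.one_lt_top)]
    refine integral_congr_ae (.of_forall fun ω => ?_)
    change (1 - (1 - Q ω) ^ Fintype.card ι).toReal = _
    have h1 : (1 - Q ω) ^ Fintype.card ι ≤ 1 := pow_le_one₀ bot_le tsub_le_self
    rw [ENNReal.toReal_sub_of_le h1 ENNReal.one_ne_top, ENNReal.toReal_pow,
      ENNReal.toReal_sub_of_le (hQ1 ω) ENNReal.one_ne_top, ENNReal.toReal_one]
  rw [hcov, coverageForm]
  -- The union over bands is expanded in powers of `Q`, and each moment of `Q` is a reciprocal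
  -- denominator.
  simp_rw [← sum_choose_mul_neg_one_pow]
  rw [integral_finsetSum _ fun k _ => (hint k).const_mul _]
  refine Finset.sum_congr rfl fun k _ => ?_
  rw [integral_const_mul, hpow, mul_one_div]

end Coverage

theorem mainTheorem6 {Ω : Type*} [MeasurableSpace Ω] (P : Measure Ω) [IsProbabilityMeasure P]
    {ι : Type*} [Fintype ι] [DecidableEq ι]
    (lam : ι → ℝ) (hlam : ∀ j, 0 < lam j)
    (X : ι → ℕ → Ω → Plane) (h : ι → ℕ → ι → Ω → ℝ)
    (hnet : IsFreqSelectiveNetwork P lam X h) (n : ι) (θ : ℝ) (hθ : 0 < θ) :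
    -- the denominators are at least one, for the exact and for the approximate coefficients
    (∀ k ∈ Finset.Icc 1 (Fintype.card ι),
      1 ≤ coverageDenominator lam n θ (zZero θ 4) k ∧
      1 ≤ coverageDenominator lam n θ (zZeroApprox θ) k) ∧
    -- the coverage probability without noise and for path-loss exponent four
    coverageProbability P 4 0 X h n θ = coverageForm lam n θ (zZero θ 4) ∧
    -- the approximation of the coefficients
    Asymptotics.IsEquivalent Filter.atTop (fun l : ℕ => zZero θ 4 l) (zZeroApprox θ) ∧
    (∀ l : ℕ, 1 ≤ l → zZeroApprox θ l ≤ zZero θ 4 l ∧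
      zZero θ 4 l ≤ (1 + 1 / (l : ℝ)) * zZeroApprox θ l) ∧
    -- the approximation of the coverage probability
    |coverageProbability P 4 0 X h n θ - coverageForm lam n θ (zZeroApprox θ)| ≤
      ∑ k ∈ Finset.Icc 1 (Fintype.card ι), ((Fintype.card ι).choose k : ℝ) /
          (coverageDenominator lam n θ (zZero θ 4) k *
            coverageDenominator lam n θ (zZeroApprox θ) k) *
        ∑ l ∈ Finset.Icc 1 k, (k.choose l : ℝ) *
          ∑ j ∈ Finset.univ.erase n, lam j / lam n * (zZeroApprox θ l / l) := by
  have hcov := hnet.coverageProbability_eq hlam hθ n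
  refine ⟨fun k _ => ⟨one_le_coverageDenominator hlam n hθ (sum_choose_mul_zZero_nonneg hθ k),
    one_le_coverageDenominator hlam n hθ (sum_choose_mul_zZeroApprox_nonneg θ k)⟩, hcov,
    isEquivalent_zZero θ, fun l hl => ⟨zZeroApprox_le_zZero θ hl, zZero_le_zZeroApprox θ hl⟩, ?_⟩
  rw [hcov]
  exact abs_coverageForm_sub_le hlam n hθ
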